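/- Let $D$ be a set with a $\sigma$-algebra (for instance any subset of $\mathbb R^d$), let $\varrho_D$ be a $\sigma$-finite measure on $D$, and let $H(K)$ be a separable reproducing kernel Hilbert space of measurable complex-valued functions on $D$ with kernel $K$ of finite trace, $\int_D K(x,x)\,\varrho_D(dx)<\infty$. Let $\mathrm{Id}:H(K)\to L_2(D,\varrho_D)$ be the embedding and $W=\mathrm{Id}^*\circ\mathrm{Id}$. Let $\lambda_1\ge\lambda_2\ge\dots$ be the positive eigenvalues of $W$, counted with multiplicity and continued by $0$ if there are only finitely many, with eigenvectors $e_j$ (for $\lambda_j>0$) orthonormal in $H(K)$; put $\sigma_j=\sqrt{\lambda_j}$ (the singular numbers of $\mathrm{Id}$) and $\eta_j=\lambda_j^{-1/2}e_j$. Let $\delta\in(0,1/3)$ and $n\in\mathbb N$ be such that $$m:=\left\lfloor\frac{n}{96(\sqrt2\log(2n)-\log\delta)}\right\rfloor\ge 2,$$ and assume $\sigma_m>0$ (in particular $\varrho_D$ is non-trivial; the assumption always holds if there are infinitely many positive eigenvalues). Then $\sum_j\sigma_j^2<\infty$, and with $$\varrho_m(x)=\frac12\left(\frac1{m-1}\sum_{j=1}^{m-1}|\eta_j(x)|^2+\Big(\sum_{j\ge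 m}\lambda_j\Big)^{-1}\Big(K(x,x)-\sum_{j=1}^{m-1}|e_j(x)|^2\Big)\right)$$ the measure $\mu_m(A)=\int_A\varrho_m\,d\varrho_D$ is a probability measure. For nodes $\mathbf X=(x^1,\dots,x^n)\in D^n$ let $\widetilde{\mathbf L}_m\in\mathbb C^{n\times(m-1)}$ have the entries $\eta_j(x^k)/\sqrt{\varrho_m(x^k)}$, and for $f\in H(K)$ let $\mathbf g\in\mathbb C^n$ have the entries $f(x^k)/\sqrt{\varrho_m(x^k)}$ (in both cases $0$ where $\varrho_m(x^k)=0$). If $\widetilde{\mathbf L}_m$ has full column rank, the weighted least squares approximant of $f$ is $\widetilde S^m_{\mathbf X}f=\sum_{j=1}^{m-1}\tilde c_j\eta_j$ with $(\tilde c_j)_{j=1}^{m-1}=(\widetilde{\mathbf L}_m^*\widetilde{\mathbf L}_m)^{-1}\widetilde{\mathbf L}_m^*\mathbf g$. If the nodes $x^1,\dots,x^n$ are drawn i.i.d. according to $\mu_m$, then with probability at least $1-3\delta$ the matrix $\widetilde{\mathbf L}_m$ has full column rank and $$\sup_{\|f\|_{H(K)}\le1}\|f-\widetilde S^m_{\mathbf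 X}f\|^2_{L_2(D,\varrho_D)}\le\frac C\delta\max\Big\{\sigma_m^2,\ \frac{\log(8n)}n\sum_{j\ge m}\sigma_j^2\Big\},$$ where $C=3+16C_R^2+4\sqrt2\,C_R<49.5$ and $C_R=\sqrt2+\frac1{4\sqrt{2\log 8}}$; moreover the set of the $\mathbf X\in D^n$ with these two properties is measurable. -/

import Mathlib

open MeasureTheory
open scoped ENNReal InnerProductSpace Matrix

noncomputable section

namespace WLS

variable {D : Type*} {H : Type*}
  [NormedAddCommGroup H] [InnerProductSpace ℂ H] [CompleteSpace H] [RKHS ℂ H D ℂ]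

/-- The scalar reproducing kernel `K(x, y)` of the reproducing kernel Hilbert space `H`
of complex-valued functions on `D`. -/
def kernel (H : Type*) [NormedAddCommGroup H] [InnerProductSpace ℂ H] [CompleteSpace H]
    [RKHS ℂ H D ℂ] (x y : D) : ℂ :=
  RKHS.kernel H x y 1

/-- The reproducing property `f(x) = ⟨f, K(·, x)⟩`; Mathlib's inner product is linear in the
second argument. -/
theorem exists_kernel_section (x : D) :
    ∃ k : H, (∀ y, k y = kernel H y x) ∧ ∀ f : H, f x = ⟪k, f⟫_ℂ :=
  ⟨RKHS.kerFun H x 1, fun y => RKHS.kerFun_apply H x 1 y, fun f => by simp⟩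

/-- The diagonal `K(x, x)` of the kernel, which is a nonnegative real number. -/
def kernelDiag (H : Type*) [NormedAddCommGroup H] [InnerProductSpace ℂ H] [CompleteSpace H]
    [RKHS ℂ H D ℂ] (x : D) : ℝ :=
  (kernel H x x).re

theorem kernelDiag_eq (x : D) : kernelDiag H x = ‖RKHS.kerFun H x (1 : ℂ)‖ ^ 2 := by
  have h := RKHS.kerFun_inner (𝕜 := ℂ) x (1 : ℂ) (RKHS.kerFun H x (1 : ℂ))
  rw [inner_self_eq_norm_sq_to_K, RKHS.kerFun_apply] at h
  have h2 := congrArg Complex.re h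
  simp only [RCLike.inner_apply, map_one, mul_one] at h2
  rw [kernelDiag, kernel, ← h2]
  norm_cast

theorem norm_apply_sq_le (f : H) (x : D) : ‖f x‖ ^ 2 ≤ ‖f‖ ^ 2 * kernelDiag H x := by
  have h := RKHS.kerFun_inner (𝕜 := ℂ) x (1 : ℂ) f
  simp only [RCLike.inner_apply, map_one, mul_one] at h
  rw [kernelDiag_eq, ← h, ← mul_pow, mul_comm ‖f‖]
  gcongr
  exact norm_inner_le_norm _ _

variable [MeasurableSpace D]

/-- The finite trace condition `∫ K(x, x) dρ(x) < ∞`. -/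
def FiniteTrace (H : Type*) [NormedAddCommGroup H] [InnerProductSpace ℂ H] [CompleteSpace H]
    [RKHS ℂ H D ℂ] (ρ : Measure D) : Prop :=
  ∫⁻ x, ENNReal.ofReal (kernelDiag H x) ∂ρ < ∞

theorem eLpNorm_le (ρ : Measure D) (f : H) :
    eLpNorm f 2 ρ ≤
      ENNReal.ofReal ‖f‖ * (∫⁻ x, ENNReal.ofReal (kernelDiag H x) ∂ρ) ^ (1 / 2 : ℝ) := by
  rw [eLpNorm_eq_lintegral_rpow_enorm_toReal (by norm_num) (by norm_num)]
  have h1 : ∫⁻ x, ‖f x‖ₑ ^ (2 : ℝ) ∂ρ ≤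
      ENNReal.ofReal ‖f‖ ^ (2 : ℝ) * ∫⁻ x, ENNReal.ofReal (kernelDiag H x) ∂ρ := by
    rw [← lintegral_const_mul' _ _ (by finiteness)]
    refine lintegral_mono fun x => ?_
    rw [← ofReal_norm, ENNReal.ofReal_rpow_of_nonneg (norm_nonneg _) (by norm_num),
      ENNReal.ofReal_rpow_of_nonneg (norm_nonneg _) (by norm_num),
      ← ENNReal.ofReal_mul (by positivity)]
    refine ENNReal.ofReal_le_ofReal ?_
    simpa using norm_apply_sq_le f x
  simp only [ENNReal.toReal_ofNat]
  refine (ENNReal.rpow_le_rpow h1 (by norm_num)).trans_eq ?_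
  rw [ENNReal.mul_rpow_of_nonneg _ _ (by norm_num), ← ENNReal.rpow_mul]
  norm_num

theorem memLp (ρ : Measure D) (hmeas : ∀ f : H, Measurable f) (htr : FiniteTrace H ρ) (f : H) :
    MemLp f 2 ρ := by
  refine ⟨(hmeas f).aestronglyMeasurable, (eLpNorm_le ρ f).trans_lt ?_⟩
  exact ENNReal.mul_lt_top ENNReal.ofReal_lt_top
    (ENNReal.rpow_lt_top_of_nonneg (by norm_num) (ne_of_lt htr))

/-- The embedding `Id : H(K) → L₂(D, ρ)`, which sends a function to its equivalence class. -/
def embedding (ρ : Measure D) (hmeas : ∀ f : H, Measurable f) (htr : FiniteTrace H ρ) :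
    H →L[ℂ] Lp ℂ 2 ρ :=
  LinearMap.mkContinuous
    { toFun := fun f => (memLp ρ hmeas htr f).toLp f
      map_add' := fun f g => by
        rw [← MemLp.toLp_add]
        exact MemLp.toLp_congr _ _ (by rw [RKHS.coe_add])
      map_smul' := fun c f => by
        rw [RingHom.id_apply, ← MemLp.toLp_const_smul]
        exact MemLp.toLp_congr _ _ (by rw [RKHS.coe_smul]) }
    (((∫⁻ x, ENNReal.ofReal (kernelDiag H x) ∂ρ) ^ (1 / 2 : ℝ)).toReal)
    (fun f => by
      simp only [LinearMap.coe_mk, AddHom.coe_mk, Lp.norm_toLp]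
      have h := ENNReal.toReal_mono (ENNReal.mul_lt_top ENNReal.ofReal_lt_top
        (ENNReal.rpow_lt_top_of_nonneg (by norm_num) (ne_of_lt htr))).ne (eLpNorm_le ρ f)
      rw [ENNReal.toReal_mul, ENNReal.toReal_ofReal (norm_nonneg _)] at h
      rw [mul_comm]
      exact h)

theorem coeFn_embedding (ρ : Measure D) (hmeas : ∀ f : H, Measurable f) (htr : FiniteTrace H ρ)
    (f : H) : embedding ρ hmeas htr f =ᵐ[ρ] f :=
  MemLp.coeFn_toLp (memLp ρ hmeas htr f)

/-- The operator `W = Id* ∘ Id : H(K) → H(K)`. -/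
def covOp (ρ : Measure D) (hmeas : ∀ f : H, Measurable f) (htr : FiniteTrace H ρ) : H →L[ℂ] H :=
  (embedding ρ hmeas htr).adjoint ∘L embedding ρ hmeas htr

/-- `(lam j, e j)`, over the indices with `0 < lam j`, is the system of the eigenpairs of `W`
with positive eigenvalue: the eigenvalues are arranged in non-increasing order, the eigenvectors
are orthonormal, and every positive eigenvalue occurs with its full multiplicity. Indices start
at `0`, so `lam j` is the `(j+1)`-st eigenvalue. If there are only finitely many positive
eigenvalues, the sequence `lam` is continued by zeros (and `e j` is irrelevant there). -/
structure IsEigenSystem (W : H →L[ℂ] H) (lam : ℕ → ℝ) (e : ℕ → H) : Prop where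
  antitone : Antitone lam
  nonneg : ∀ j, 0 ≤ lam j
  apply_eq : ∀ j, 0 < lam j → W (e j) = (lam j : ℂ) • e j
  orthonormal : Orthonormal ℂ (fun j : {j : ℕ // 0 < lam j} => e j)
  complete : ∀ (μ : ℝ) (v : H), 0 < μ → W v = (μ : ℂ) • v →
    (∀ j, 0 < lam j → ⟪e j, v⟫_ℂ = 0) → v = 0

/-- The singular numbers: `sing lam j` is the `(j+1)`-st one, the root of the `(j+1)`-st
eigenvalue. -/
def sing (lam : ℕ → ℝ) (j : ℕ) : ℝ := Real.sqrt (lam j)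

/-- The functions `η = lam^(-1/2) e`, orthonormal in `L₂(D, ρ)`. -/
def eta (lam : ℕ → ℝ) (e : ℕ → H) (j : ℕ) : H := ((sing lam j : ℂ)⁻¹) • e j

/-- The importance sampling density
`ϱ_m = 1/2 ((m-1)⁻¹ ∑_{j<m} |η_j|² + (∑_{j≥m} λ_j)⁻¹ (K(x,x) - ∑_{j<m} |e_j|²))`
(indices counted from `1` in this formula). -/
def density (lam : ℕ → ℝ) (e : ℕ → H) (m : ℕ) (x : D) : ℝ :=
  1 / 2 * (((m : ℝ) - 1)⁻¹ * ∑ j ∈ Finset.range (m - 1), ‖eta lam e j x‖ ^ 2 +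
    (∑' j, lam (j + (m - 1)))⁻¹ *
      (kernelDiag H x - ∑ j ∈ Finset.range (m - 1), ‖e j x‖ ^ 2))

/-- The sampling measure `μ_m(A) = ∫_A ϱ_m dρ`. -/
def samplingMeasure (ρ : Measure D) (lam : ℕ → ℝ) (e : ℕ → H) (m : ℕ) : Measure D :=
  ρ.withDensity fun x => ENNReal.ofReal (density lam e m x)

/-- The weighted matrix with entries `η_j(x^k) / √ϱ_m(x^k)`, or `0` where `ϱ_m(x^k) = 0`. -/
def weightedMatrix (lam : ℕ → ℝ) (e : ℕ → H) (m : ℕ) {n : ℕ} (X : Fin n → D) :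
    Matrix (Fin n) (Fin (m - 1)) ℂ :=
  Matrix.of fun k j =>
    if density lam e m (X k) = 0 then 0
    else eta lam e j (X k) / (Real.sqrt (density lam e m (X k)) : ℂ)

/-- The reweighted samples `f(x^k) / √ϱ_m(x^k)`, or `0` where `ϱ_m(x^k) = 0`. -/
def weightedSamples (lam : ℕ → ℝ) (e : ℕ → H) (m : ℕ) {n : ℕ} (X : Fin n → D) (f : H) :
    Fin n → ℂ :=
  fun k =>
    if density lam e m (X k) = 0 then 0
    else f (X k) / (Real.sqrt (density lam e m (X k)) : ℂ)

/-- The least squares coefficients `(L* L)⁻¹ L* g`. -/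
def coeffs (lam : ℕ → ℝ) (e : ℕ → H) (m : ℕ) {n : ℕ} (X : Fin n → D) (f : H) :
    Fin (m - 1) → ℂ :=
  ((weightedMatrix lam e m X)ᴴ * weightedMatrix lam e m X)⁻¹ *ᵥ
    ((weightedMatrix lam e m X)ᴴ *ᵥ weightedSamples lam e m X f)

/-- The weighted least squares approximant `∑_{j<m} c_j η_j` of `f` from its values at the
nodes `X`. -/
def approximant (lam : ℕ → ℝ) (e : ℕ → H) (m : ℕ) {n : ℕ} (X : Fin n → D) (f : H) : H :=
  ∑ j : Fin (m - 1), coeffs lam e m X f j • eta lam e j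

/-- The squared worst-case error `sup_{‖f‖ ≤ 1} ‖f - S f‖²` in `L₂(D, ρ)`, as an extended
nonnegative real. -/
def worstCaseErrorSq (ρ : Measure D) (hmeas : ∀ f : H, Measurable f) (htr : FiniteTrace H ρ)
    (lam : ℕ → ℝ) (e : ℕ → H) (m : ℕ) {n : ℕ} (X : Fin n → D) : ℝ≥0∞ :=
  ⨆ (f : H) (_ : ‖f‖ ≤ 1), ‖embedding ρ hmeas htr (f - approximant lam e m X f)‖ₑ ^ 2

/-- The node tuples for which the least squares problem has full column rank (so that the
approximant is well defined) and the squared worst-case error is at most `t`. -/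
def successSet (ρ : Measure D) (hmeas : ∀ f : H, Measurable f) (htr : FiniteTrace H ρ)
    (lam : ℕ → ℝ) (e : ℕ → H) (m n : ℕ) (t : ℝ) : Set (Fin n → D) :=
  {X | (weightedMatrix lam e m X).rank = m - 1 ∧
    worstCaseErrorSq ρ hmeas htr lam e m X ≤ ENNReal.ofReal t}

/-- The constant `C_R`. -/
def constR : ℝ := Real.sqrt 2 + 1 / (4 * Real.sqrt (2 * Real.log 8))

/-- The constant `C = 3 + 16 C_R² + 4 √2 C_R`. -/
def constC : ℝ := 3 + 16 * constR ^ 2 + 4 * Real.sqrt 2 * constR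

end WLS

end

/-! Notation: λ_m is `lam (m - 1)`, T = ∑_{j≥m} λ_j, and r is f minus its projection onto the first
m-1 eigenvectors.

Deterministic part. Least squares reproduces the span of η_1, ..., η_{m-1}, so f - Sf = r - Sr, and
Pythagoras in L₂ gives ‖f - Sf‖² = ‖r‖² + |d|², where d are the coefficients of Sr. The first term
is at most λ_m ‖f‖². If the Gram matrix L*L is at least n/4, then |d|² ≤ (4/n) ∑ₖ |r(xᵏ)|²/ϱ_m(xᵏ);
if moreover this sum over the nodes is at most s on the unit ball, the squared error is at most λ_m
+ 4s/n (`IsEigenSystem.mem_successSet`).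

Probabilistic part. Both conditions bound an extreme eigenvalue of a sum ∑ₖ yₖyₖ* of independent
rank-one matrices: from below for the vectors made of the η_j, from above for those made of the e_j
with j ≥ m. The two halves of ϱ_m bound |y|² by 2(m-1) and by 2T respectively. The eigenvalues are
controlled by Markov's inequality for the trace of a high power, and the moments by an exchangeable
pair: replacing one sample by an independent copy bounds each trace moment by those of lower order
(`integral_trace_pow_le`). The upper bound involves the dimension only through the trace T, so it
passes to the infinite system of the e_j with j ≥ m.

Functional analysis. Finite trace makes the embedding compact, hence functions orthogonal to all e_j
vanish almost everywhere. By separability one null set serves for all of them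
(`IsEigenSystem.ae_isRegular`). Off this set K(x,x) = ∑ |e_j(x)|², and r is the pointwise sum of its
eigenvector series. This yields the normalization of ϱ_m and lets the finite-dimensional tail bound
control r at the nodes. -/

noncomputable section

namespace WLS


/-! ### Scalar power inequalities -/

section PowerInequalities

/-- The two factors have the same sign: powers are monotone on nonnegative numbers, and for even `k`
the exponents `q` and `k - q` have the same parity, so both powers depend only on |a|, |b| or both
are monotone on the whole line. -/
theorem pow_sub_mul_pow_sub_nonneg {k : ℕ} {a b : ℝ} (h : Even k ∨ (0 ≤ a ∧ 0 ≤ b)) {q : ℕ}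
    (hq : q ≤ k) : 0 ≤ (a ^ q - b ^ q) * (a ^ (k - q) - b ^ (k - q)) := by
  have key : ∀ {u v : ℝ}, 0 ≤ u → 0 ≤ v → ∀ r s : ℕ, 0 ≤ (u ^ r - v ^ r) * (u ^ s - v ^ s) := by
    intro u v hu hv r s
    rcases le_total u v with huv | huv
    · exact mul_nonneg_of_nonpos_of_nonpos (sub_nonpos.2 (pow_le_pow_left₀ hu huv r))
        (sub_nonpos.2 (pow_le_pow_left₀ hu huv s))
    · exact mul_nonneg (sub_nonneg.2 (pow_le_pow_left₀ hv huv r))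
        (sub_nonneg.2 (pow_le_pow_left₀ hv huv s))
  rcases h with hk | ⟨ha, hb⟩
  · rcases Nat.even_or_odd q with hq' | hq'
    · have hr : Even (k - q) := (Nat.even_sub hq).2 (iff_of_true hk hq')
      have := key (abs_nonneg a) (abs_nonneg b) q (k - q)
      rwa [hq'.pow_abs, hq'.pow_abs, hr.pow_abs, hr.pow_abs] at this
    · have hr : Odd (k - q) := Nat.Even.sub_odd hq hk hq'
      rcases le_total a b with hab | hab
      · exact mul_nonneg_of_nonpos_of_nonpos (sub_nonpos.2 (hq'.strictMono_pow.monotone hab))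
          (sub_nonpos.2 (hr.strictMono_pow.monotone hab))
      · exact mul_nonneg (sub_nonneg.2 (hq'.strictMono_pow.monotone hab))
          (sub_nonneg.2 (hr.strictMono_pow.monotone hab))
  · exact key ha hb _ _

/-- Pair each term with its mirror image: a^k + b^k minus such a pair is the product in
`pow_sub_mul_pow_sub_nonneg`. -/
theorem sum_pow_mul_pow_le {k : ℕ} {a b : ℝ} (h : Even k ∨ (0 ≤ a ∧ 0 ≤ b)) :
    ∑ q ∈ Finset.range (k + 1), a ^ q * b ^ (k - q) ≤ (k + 1) / 2 * (a ^ k + b ^ k) := by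
  have h1 : ∑ q ∈ Finset.range (k + 1), a ^ q * b ^ (k - q) =
      ∑ q ∈ Finset.range (k + 1), a ^ (k - q) * b ^ q := by
    rw [← Finset.sum_range_reflect]
    refine Finset.sum_congr rfl fun q hq => ?_
    have : q ≤ k := Nat.lt_succ_iff.1 (Finset.mem_range.1 hq)
    rw [show k + 1 - 1 - q = k - q by omega, Nat.sub_sub_self this]
  have h2 : ∑ q ∈ Finset.range (k + 1), (a ^ q * b ^ (k - q) + a ^ (k - q) * b ^ q) ≤
      ∑ q ∈ Finset.range (k + 1), (a ^ k + b ^ k) := by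
    refine Finset.sum_le_sum fun q hq => ?_
    have hqk : q ≤ k := Nat.lt_succ_iff.1 (Finset.mem_range.1 hq)
    have h3 := pow_sub_mul_pow_sub_nonneg h hqk
    have ha : a ^ k = a ^ q * a ^ (k - q) := by rw [← pow_add, Nat.add_sub_cancel' hqk]
    have hb : b ^ k = b ^ q * b ^ (k - q) := by rw [← pow_add, Nat.add_sub_cancel' hqk]
    rw [ha, hb]
    linarith
  rw [Finset.sum_add_distrib, ← h1, Finset.sum_const, Finset.card_range, nsmul_eq_mul] at h2
  push_cast at h2
  linarith

theorem sub_mul_pow_sub_le {k : ℕ} {a b : ℝ} (h : Even k ∨ (0 ≤ a ∧ 0 ≤ b)) :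
    (a - b) * (a ^ (k + 1) - b ^ (k + 1)) ≤ (k + 1) / 2 * ((a - b) ^ 2 * (a ^ k + b ^ k)) := by
  have h1 := geom_sum₂_mul a b (k + 1)
  rw [← h1]
  have h2 := mul_le_mul_of_nonneg_left (sum_pow_mul_pow_le h) (sq_nonneg (a - b))
  simp only [Nat.add_sub_cancel] at *
  linarith

end PowerInequalities

/-! ### Trace inequalities for powers of Hermitian matrices -/

section Trace

open scoped ComplexOrder MatrixOrder

variable {ι : Type*}

/-- The matrix `v v*`. -/
def rankOne (v : ι → ℂ) : Matrix ι ι ℂ := Matrix.vecMulVec v (star v)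

variable [Fintype ι]

theorem rankOne_mul_self (v : ι → ℂ) :
    rankOne v * rankOne v = ((∑ i, ‖v i‖ ^ 2 : ℝ) : ℂ) • rankOne v := by
  have h : star v ⬝ᵥ v = ((∑ i, ‖v i‖ ^ 2 : ℝ) : ℂ) := by
    push_cast
    exact Finset.sum_congr rfl fun i _ => Complex.conj_mul' _
  rw [rankOne, Matrix.vecMulVec_mul_vecMulVec, h]
  ext i j
  simp [Matrix.vecMulVec_apply, mul_left_comm]

theorem posSemidef_rankOne (v : ι → ℂ) : (rankOne v).PosSemidef :=
  Matrix.posSemidef_vecMulVec_self_star v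

variable [DecidableEq ι]

theorem trace_diagonal_mul_mul_diagonal_mul (a b : ι → ℂ) (Z : Matrix ι ι ℂ) :
    (Matrix.diagonal a * Z * Matrix.diagonal b * Zᴴ).trace =
      ∑ i, ∑ j, ((Complex.normSq (Z i j) : ℝ) : ℂ) * (a i * b j) := by
  rw [Matrix.trace]
  refine Finset.sum_congr rfl fun i _ => ?_
  rw [Matrix.diag_apply, Matrix.mul_apply]
  refine Finset.sum_congr rfl fun j _ => ?_
  rw [Matrix.mul_diagonal, Matrix.diagonal_mul, Matrix.conjTranspose_apply, ← Complex.mul_conj,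
    starRingEnd_apply]
  ring

theorem pow_eq_conj_diagonal {A : Matrix ι ι ℂ} (hA : A.IsHermitian) (a : ℕ) :
    A ^ a = (hA.eigenvectorUnitary : Matrix ι ι ℂ) *
      Matrix.diagonal (fun i => ((hA.eigenvalues i ^ a : ℝ) : ℂ)) *
      (hA.eigenvectorUnitary : Matrix ι ι ℂ)ᴴ := by
  conv_lhs => rw [hA.spectral_theorem]
  rw [← map_pow, Unitary.conjStarAlgAut_apply, Matrix.diagonal_pow, Matrix.star_eq_conjTranspose]
  congr 3
  ext i
  simp

/-- The traces of all the products of a power of `B` with a power of `C` are given by the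
eigenvalues and by the squared moduli of the scalar products of the eigenvectors. -/
theorem exists_trace_pow_mul_pow {B C : Matrix ι ι ℂ} (hB : B.IsHermitian) (hC : C.IsHermitian) :
    ∃ w : ι → ι → ℝ, (∀ i j, 0 ≤ w i j) ∧ ∀ a b : ℕ, (B ^ a * C ^ b).trace.re =
      ∑ i, ∑ j, w i j * (hB.eigenvalues i ^ a * hC.eigenvalues j ^ b) := by
  set U : Matrix ι ι ℂ := (hB.eigenvectorUnitary : Matrix ι ι ℂ)
  set V : Matrix ι ι ℂ := (hC.eigenvectorUnitary : Matrix ι ι ℂ)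
  refine ⟨fun i j => Complex.normSq ((Uᴴ * V) i j), fun i j => Complex.normSq_nonneg _,
    fun a b => ?_⟩
  rw [pow_eq_conj_diagonal hB, pow_eq_conj_diagonal hC]
  have h : (U * Matrix.diagonal (fun i => ((hB.eigenvalues i ^ a : ℝ) : ℂ)) * Uᴴ *
      (V * Matrix.diagonal (fun i => ((hC.eigenvalues i ^ b : ℝ) : ℂ)) * Vᴴ)).trace =
      (Matrix.diagonal (fun i => ((hB.eigenvalues i ^ a : ℝ) : ℂ)) * (Uᴴ * V) *
        Matrix.diagonal (fun i => ((hC.eigenvalues i ^ b : ℝ) : ℂ)) * (Uᴴ * V)ᴴ).trace := by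
    rw [Matrix.conjTranspose_mul, Matrix.conjTranspose_conjTranspose]
    simp only [Matrix.mul_assoc]
    rw [Matrix.trace_mul_comm]
    simp only [Matrix.mul_assoc]
  rw [h, trace_diagonal_mul_mul_diagonal_mul, Complex.re_sum]
  refine Finset.sum_congr rfl fun i _ => ?_
  rw [Complex.re_sum]
  refine Finset.sum_congr rfl fun j _ => ?_
  norm_cast

/-- By cyclicity of the trace every term of the expansion is a trace of some B^a C^b.
`exists_trace_pow_mul_pow` turns all of them into sums over pairs of eigenvalues with the same
nonnegative weights, and `sub_mul_pow_sub_le` applies to each pair. -/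
theorem trace_sub_mul_pow_sub_le {B C : Matrix ι ι ℂ} {k : ℕ} (hB : B.IsHermitian)
    (hC : C.IsHermitian) (h : Even k ∨ (B.PosSemidef ∧ C.PosSemidef)) :
    ((B - C) * (B ^ (k + 1) - C ^ (k + 1))).trace.re ≤
      (k + 1) / 2 * ((B - C) * (B - C) * (B ^ k + C ^ k)).trace.re := by
  obtain ⟨w, hw, hwt⟩ := exists_trace_pow_mul_pow hB hC
  have e1 : ((B - C) * (B ^ (k + 1) - C ^ (k + 1))).trace =
      (B ^ (k + 2) * C ^ 0).trace - (B ^ (k + 1) * C ^ 1).trace - (B ^ 1 * C ^ (k + 1)).trace +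
        (B ^ 0 * C ^ (k + 2)).trace := by
    have : (B - C) * (B ^ (k + 1) - C ^ (k + 1)) =
        B ^ (k + 2) - C * B ^ (k + 1) - B * C ^ (k + 1) + C ^ (k + 2) := by
      rw [sub_mul, mul_sub, mul_sub, ← pow_succ', ← pow_succ']
      abel
    rw [this, Matrix.trace_add, Matrix.trace_sub, Matrix.trace_sub, Matrix.trace_mul_comm C]
    simp
  have e2 : ((B - C) * (B - C) * (B ^ k + C ^ k)).trace =
      (B ^ (k + 2) * C ^ 0).trace - 2 * (B ^ (k + 1) * C ^ 1).trace + (B ^ k * C ^ 2).trace +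
        (B ^ 2 * C ^ k).trace - 2 * (B ^ 1 * C ^ (k + 1)).trace + (B ^ 0 * C ^ (k + 2)).trace := by
    have : (B - C) * (B - C) * (B ^ k + C ^ k) =
        B ^ (k + 2) - B * (C * B ^ k) - C * B ^ (k + 1) + C ^ 2 * B ^ k +
        B ^ 2 * C ^ k - B * C ^ (k + 1) - C * (B * C ^ k) + C ^ (k + 2) := by
      rw [pow_succ' B (k + 1), pow_succ' B k, pow_succ' C (k + 1), pow_succ' C k, sq, sq]
      noncomm_ring
    rw [this]
    simp only [Matrix.trace_add, Matrix.trace_sub]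
    rw [Matrix.trace_mul_comm B (C * B ^ k), Matrix.mul_assoc, ← pow_succ,
      Matrix.trace_mul_comm C (B * C ^ k), Matrix.mul_assoc, ← pow_succ,
      Matrix.trace_mul_comm C (B ^ (k + 1)), Matrix.trace_mul_comm (C ^ 2) (B ^ k)]
    simp only [pow_zero, pow_one, mul_one, one_mul]
    ring
  have r2 : ∀ z : ℂ, (2 * z).re = 2 * z.re := fun z => by simp
  rw [e1, e2]
  simp only [Complex.add_re, Complex.sub_re, r2, hwt, Finset.mul_sum, ← Finset.sum_add_distrib,
    ← Finset.sum_sub_distrib]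
  refine Finset.sum_le_sum fun i _ => Finset.sum_le_sum fun j _ => ?_
  have h3 : Even k ∨ (0 ≤ hB.eigenvalues i ∧ 0 ≤ hC.eigenvalues j) :=
    h.imp_right fun h => ⟨h.1.eigenvalues_nonneg i, h.2.eigenvalues_nonneg j⟩
  have h4 := mul_le_mul_of_nonneg_left (sub_mul_pow_sub_le h3) (hw i j)
  refine le_of_eq_of_le ?_ (h4.trans_eq ?_) <;> ring

theorem trace_mul_re_nonneg {A B : Matrix ι ι ℂ} (hA : A.PosSemidef) (hB : B.PosSemidef) :
    0 ≤ (A * B).trace.re := by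
  obtain ⟨R, rfl⟩ := CStarAlgebra.nonneg_iff_eq_star_mul_self.1 hA.nonneg
  rw [Matrix.star_eq_conjTranspose]
  rw [Matrix.mul_assoc, Matrix.trace_mul_comm]
  exact (Complex.le_def.1 (hB.mul_mul_conjTranspose_same R).trace_nonneg).1

theorem trace_mul_re_mono {A A' B : Matrix ι ι ℂ} (hA : (A' - A).PosSemidef)
    (hB : B.PosSemidef) : (A * B).trace.re ≤ (A' * B).trace.re := by
  have := trace_mul_re_nonneg hA hB
  rw [Matrix.sub_mul, Matrix.trace_sub, Complex.sub_re] at this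
  linarith

theorem posSemidef_pow {A : Matrix ι ι ℂ} {k : ℕ} (hA : A.IsHermitian)
    (h : Even k ∨ A.PosSemidef) : (A ^ k).PosSemidef := by
  rcases h with ⟨r, rfl⟩ | h
  · rw [pow_add]
    conv => enter [1, 1]; rw [← (hA.pow r).eq]
    exact Matrix.posSemidef_conjTranspose_mul_self _
  · exact h.pow k

/-- With P = vv* and P' = v'v'*, the identities (P-P')² + (P+P')² = 2P² + 2P'² and P² = |v|²P show
that the matrix equals 2(M-|v|²)P + 2(M-|v'|²)P' + (P+P')². -/
theorem posSemidef_rankOne_sub_mul_self {v v' : ι → ℂ} {M : ℝ} (hv : ∑ i, ‖v i‖ ^ 2 ≤ M)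
    (hv' : ∑ i, ‖v' i‖ ^ 2 ≤ M) :
    (((2 * M : ℝ) : ℂ) • (rankOne v + rankOne v') -
      (rankOne v - rankOne v') * (rankOne v - rankOne v')).PosSemidef := by
  have h1 : ∀ u : ι → ℂ, ∑ i, ‖u i‖ ^ 2 ≤ M →
      (((2 * (M - ∑ i, ‖u i‖ ^ 2) : ℝ) : ℂ) • rankOne u).PosSemidef := fun u hu =>
    (posSemidef_rankOne u).smul (by
      rw [Complex.zero_le_real]; linarith)
  have h2 : ((rankOne v + rankOne v') * (rankOne v + rankOne v')).PosSemidef := by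
    have := posSemidef_pow (k := 2) ((posSemidef_rankOne v).add (posSemidef_rankOne v')).1
      (Or.inl even_two)
    rwa [sq] at this
  have h3 := ((h1 v hv).add (h1 v' hv')).add h2
  convert h3 using 1
  simp only [sub_mul, mul_sub, add_mul, mul_add, rankOne_mul_self]
  push_cast
  module

end Trace


/-! ### The exchangeable pair and the moment recursion -/

section Exchange

open scoped ComplexOrder MatrixOrder

variable {ι : Type*}

theorem continuous_rankOne : Continuous (rankOne : (ι → ℂ) → Matrix ι ι ℂ) := by
  unfold rankOne
  fun_prop

/-- The matrix `∑ₖ zₖ zₖ*`. -/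
def sampleSum {n : ℕ} (z : Fin n → ι → ℂ) : Matrix ι ι ℂ := ∑ k, rankOne (z k)

theorem continuous_sampleSum {n : ℕ} :
    Continuous (sampleSum : (Fin n → ι → ℂ) → Matrix ι ι ℂ) :=
  continuous_finsetSum _ fun k _ => continuous_rankOne.comp (continuous_apply k)

/-- Index `0` holds the independent copy and the indices `k.succ` the actual samples; the
transposition puts the copy in the place of sample `i`. -/
theorem sampleSum_swap {n : ℕ} (z : Fin (n + 1) → ι → ℂ) (i : Fin n) :
    sampleSum (fun k : Fin n => z (Equiv.swap 0 i.succ k.succ)) =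
      sampleSum (fun k : Fin n => z k.succ) - rankOne (z i.succ) + rankOne (z 0) := by
  unfold sampleSum
  rw [← Finset.add_sum_erase _ _ (Finset.mem_univ i),
    ← Finset.add_sum_erase (a := i) _ (fun k : Fin n => rankOne (z k.succ)) (Finset.mem_univ i),
    show (fun k : Fin n => z (Equiv.swap 0 i.succ k.succ)) i = z 0 by simp]
  have : ∑ k ∈ Finset.univ.erase i, rankOne (z (Equiv.swap 0 i.succ k.succ)) =
      ∑ k ∈ Finset.univ.erase i, rankOne (z k.succ) := by
    refine Finset.sum_congr rfl fun k hk => ?_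
    rw [Equiv.swap_apply_of_ne_of_ne (Fin.succ_ne_zero k)
      (fun h => (Finset.mem_erase.1 hk).1 (Fin.succ_injective n h))]
  rw [this]
  abel

/-- The matrix `∑ₖ zₖ zₖ* - c`. -/
def shiftedSum [DecidableEq ι] {n : ℕ} (c : ℝ) (z : Fin n → ι → ℂ) : Matrix ι ι ℂ := sampleSum z - (c : ℂ) • 1

theorem continuous_shiftedSum [DecidableEq ι] {n : ℕ} (c : ℝ) :
    Continuous (shiftedSum c : (Fin n → ι → ℂ) → Matrix ι ι ℂ) :=
  continuous_sampleSum.sub continuous_const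

theorem shiftedSum_zero [DecidableEq ι] {n : ℕ} (z : Fin n → ι → ℂ) : shiftedSum 0 z = sampleSum z := by
  simp [shiftedSum]

variable [Fintype ι]

theorem posSemidef_sampleSum {n : ℕ} (z : Fin n → ι → ℂ) : (sampleSum z).PosSemidef :=
  Matrix.posSemidef_sum _ fun k _ => posSemidef_rankOne (z k)

variable {D : Type*} [MeasurableSpace D] {y : D → ι → ℂ} {M : ℝ}

/-- The bound on `y` keeps all samples in a compact polydisc, on which `g` is bounded. This provides
the integrability of the trace moments. -/
theorem integrable_continuous_comp {κ : Type*} [Fintype κ] (P : Measure (κ → D))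
    [IsFiniteMeasure P] (hym : Measurable y) (hy : ∀ x, ∑ i, ‖y x i‖ ^ 2 ≤ M)
    {g : (κ → ι → ℂ) → ℝ} (hg : Continuous g) :
    Integrable (fun ω => g fun k => y (ω k)) P := by
  have hK : IsCompact (Set.univ.pi fun _ : κ => Metric.closedBall (0 : ι → ℂ) (Real.sqrt M)) :=
    isCompact_univ_pi fun _ => isCompact_closedBall _ _
  obtain ⟨C, hC⟩ := hK.exists_bound_of_continuousOn hg.continuousOn
  refine Integrable.of_bound (C := C) ?_ (Filter.Eventually.of_forall fun ω => hC _ ?_)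
  · refine (hg.measurable.comp ?_).aestronglyMeasurable
    exact measurable_pi_lambda _ fun k => hym.comp (measurable_pi_apply k)
  · refine fun k _ => mem_closedBall_zero_iff.2 ((pi_norm_le_iff_of_nonneg (Real.sqrt_nonneg _)).2
      fun i => Real.le_sqrt_of_sq_le (le_trans ?_ (hy (ω k))))
    exact Finset.single_le_sum (f := fun i => ‖y (ω k) i‖ ^ 2) (fun _ _ => sq_nonneg _)
      (Finset.mem_univ i)

theorem measurePreserving_tail (μ : Measure D) [IsProbabilityMeasure μ] (n : ℕ) :
    MeasurePreserving (fun (ω : Fin (n + 1) → D) (k : Fin n) => ω k.succ)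
      (Measure.pi fun _ => μ) (Measure.pi fun _ => μ) :=
  measurePreserving_snd.comp (measurePreserving_piFinSuccAbove (fun _ : Fin (n + 1) => μ) 0)

theorem measurePreserving_swap (μ : Measure D) [IsProbabilityMeasure μ] {n : ℕ}
    (σ : Equiv.Perm (Fin n)) :
    MeasurePreserving (MeasurableEquiv.piCongrLeft (fun _ : Fin n => D) σ)
      (Measure.pi fun _ => μ) (Measure.pi fun _ => μ) :=
  measurePreserving_piCongrLeft (fun _ : Fin n => μ) σ

theorem piCongrLeft_const_apply {n : ℕ} (σ : Equiv.Perm (Fin n)) (ω : Fin n → D) (k : Fin n) :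
    MeasurableEquiv.piCongrLeft (fun _ : Fin n => D) σ ω k = ω (σ.symm k) := by
  have := Equiv.piCongrLeft_apply_apply (fun _ : Fin n => D) σ ω (σ.symm k)
  rw [σ.apply_symm_apply] at this
  exact this

theorem integral_trace_mul {μ : Measure D} [IsProbabilityMeasure μ] (hym : Measurable y)
    (hy : ∀ x, ∑ i, ‖y x i‖ ^ 2 ≤ M) {Λ : Matrix ι ι ℂ}
    (hΛ : ∀ i j, ∫ x, rankOne (y x) i j ∂μ = Λ i j) (A : Matrix ι ι ℂ) :
    ∫ x, (rankOne (y x) * A).trace.re ∂μ = (Λ * A).trace.re := by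
  have hint : ∀ i j, Integrable (fun x => rankOne (y x) i j * A j i) μ := fun i j => by
    refine Integrable.mul_const ?_ _
    have hm : Measurable fun x => rankOne (y x) i j := by
      simp only [rankOne, Matrix.vecMulVec_apply, Pi.star_apply]
      fun_prop
    refine Integrable.of_bound (C := M) hm.aestronglyMeasurable
      (Filter.Eventually.of_forall fun x => ?_)
    have h1 : ∀ i, ‖y x i‖ ^ 2 ≤ M := fun i => le_trans
      (Finset.single_le_sum (f := fun i => ‖y x i‖ ^ 2) (fun _ _ => sq_nonneg _)
      (Finset.mem_univ i)) (hy x)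
    simp only [rankOne, Matrix.vecMulVec_apply, Pi.star_apply, norm_mul, norm_star]
    nlinarith [h1 i, h1 j, sq_nonneg (‖y x i‖ - ‖y x j‖)]
  have e : ∀ B : Matrix ι ι ℂ, (B * A).trace = ∑ i, ∑ j, B i j * A j i := fun B => by
    simp [Matrix.trace, Matrix.mul_apply]
  have hint2 : Integrable (fun x => (rankOne (y x) * A).trace) μ := by
    simp only [e]
    exact integrable_finsetSum _ fun i _ => integrable_finsetSum _ fun j _ => hint i j
  have h := integral_re hint2
  simp only [RCLike.re_to_complex] at h
  rw [h]
  congr 1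
  simp only [e]
  rw [integral_finsetSum _ fun i _ => integrable_finsetSum _ fun j _ => hint i j]
  refine Finset.sum_congr rfl fun i _ => ?_
  rw [integral_finsetSum _ fun j _ => hint i j]
  refine Finset.sum_congr rfl fun j _ => ?_
  rw [integral_mul_const, hΛ]

/-- The copy at index `0` is independent of the samples in `A`, so by Fubini only its mean `Λ`
survives. -/
theorem integral_trace_rankOne_mul {μ : Measure D} [IsProbabilityMeasure μ] {n : ℕ}
    (hym : Measurable y) (hy : ∀ x, ∑ i, ‖y x i‖ ^ 2 ≤ M) {Λ : Matrix ι ι ℂ}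
    (hΛ : ∀ i j, ∫ x, rankOne (y x) i j ∂μ = Λ i j)
    {A : (Fin n → ι → ℂ) → Matrix ι ι ℂ} (hA : Continuous A) :
    ∫ ω : Fin (n + 1) → D, (rankOne (y (ω 0)) * A fun k => y (ω k.succ)).trace.re
        ∂(Measure.pi fun _ => μ) =
      ∫ ω : Fin n → D, (Λ * A fun k => y (ω k)).trace.re ∂(Measure.pi fun _ => μ) := by
  have hmp := measurePreserving_piFinSuccAbove (fun _ : Fin (n + 1) => μ) 0
  have h1 : ∫ ω : Fin (n + 1) → D, (rankOne (y (ω 0)) * A fun k => y (ω k.succ)).trace.re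
      ∂(Measure.pi fun _ => μ) = ∫ p : D × (Fin n → D),
      (rankOne (y p.1) * A fun k => y (p.2 k)).trace.re ∂(μ.prod (Measure.pi fun _ => μ)) :=
    hmp.integral_comp (MeasurableEquiv.measurableEmbedding _)
      (fun p : D × (Fin n → D) => (rankOne (y p.1) * A fun k => y (p.2 k)).trace.re)
  have hint : Integrable (fun p : D × (Fin n → D) =>
      (rankOne (y p.1) * A fun k => y (p.2 k)).trace.re) (μ.prod (Measure.pi fun _ => μ)) := by
    refine (hmp.integrable_comp_emb (MeasurableEquiv.measurableEmbedding _)).1 ?_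
    refine integrable_continuous_comp (g := fun z : Fin (n + 1) → ι → ℂ =>
      (rankOne (z 0) * A fun k => z k.succ).trace.re) _ hym hy ?_
    have h0 : Continuous fun z : Fin (n + 1) → ι → ℂ => rankOne (z 0) :=
      continuous_rankOne.comp (continuous_apply 0)
    have h2 : Continuous fun z : Fin (n + 1) → ι → ℂ => A fun k => z k.succ :=
      hA.comp (by fun_prop)
    exact Complex.continuous_re.comp (h0.matrix_mul h2).matrix_trace
  rw [h1, integral_prod_symm _ hint]
  exact integral_congr_ae (Filter.Eventually.of_forall fun ω =>
    integral_trace_mul hym hy hΛ (A fun k => y (ω k)))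

variable [DecidableEq ι]

theorem isHermitian_shiftedSum {n : ℕ} (c : ℝ) (z : Fin n → ι → ℂ) :
    (shiftedSum c z).IsHermitian := by
  refine (posSemidef_sampleSum z).1.sub ?_
  rw [Matrix.IsHermitian, Matrix.conjTranspose_smul, Matrix.conjTranspose_one]
  simp

theorem even_or_posSemidef_shiftedSum {n k : ℕ} {c : ℝ} (hk : Even k ∨ c = 0)
    (z : Fin n → ι → ℂ) : Even k ∨ (shiftedSum c z).PosSemidef := by
  refine hk.imp_right fun h => ?_
  rw [shiftedSum, h, Complex.ofReal_zero, zero_smul, sub_zero]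
  exact posSemidef_sampleSum z

/-- The swap τ preserves the law of the samples and changes the sign of X - X∘τ, which is the
difference of the two rank-one matrices. Hence twice the left side is the mean of tr((X -
X∘τ)(X^(k+1) - (X∘τ)^(k+1))). `trace_sub_mul_pow_sub_le` and invariance under τ reduce it to the
mean of tr((X - X∘τ)² X^k), and `posSemidef_rankOne_sub_mul_self` bounds the square. -/
theorem integral_trace_sub_mul_pow_le {μ : Measure D} [IsProbabilityMeasure μ] {n k : ℕ} {c : ℝ}
    (hym : Measurable y) (hy : ∀ x, ∑ i, ‖y x i‖ ^ 2 ≤ M) (hk : Even k ∨ c = 0) (i : Fin n) :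
    ∫ ω : Fin (n + 1) → D, ((rankOne (y (ω i.succ)) - rankOne (y (ω 0))) *
        shiftedSum c (fun k => y (ω k.succ)) ^ (k + 1)).trace.re ∂(Measure.pi fun _ => μ) ≤
      (k + 1) * M * ∫ ω : Fin (n + 1) → D, ((rankOne (y (ω i.succ)) + rankOne (y (ω 0))) *
        shiftedSum c (fun k => y (ω k.succ)) ^ k).trace.re ∂(Measure.pi fun _ => μ) := by
  set P : Measure (Fin (n + 1) → D) := Measure.pi fun _ => μ
  let X : (Fin (n + 1) → ι → ℂ) → Matrix ι ι ℂ := fun z => shiftedSum c fun k => z k.succ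
  let τ : (Fin (n + 1) → ι → ℂ) → Fin (n + 1) → ι → ℂ := fun z k => z (Equiv.swap 0 i.succ k)
  have hτ0 : ∀ z, τ z 0 = z i.succ := fun z => by simp [τ]
  have hτi : ∀ z, τ z i.succ = z 0 := fun z => by simp [τ]
  have hττ : ∀ z, τ (τ z) = z := fun z => by funext k; simp [τ]
  have hXτ : ∀ z, X z - X (τ z) = rankOne (z i.succ) - rankOne (z 0) := fun z => by
    simp only [X, τ, shiftedSum, sampleSum_swap]
    abel
  have hXc : Continuous X := (continuous_shiftedSum c).comp (by fun_prop)
  have hτc : Continuous τ := continuous_pi fun k => continuous_apply _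
  have hRc : ∀ k, Continuous fun z : Fin (n + 1) → ι → ℂ => rankOne (z k) := fun k =>
    continuous_rankOne.comp (continuous_apply k)
  have hre : ∀ {F : (Fin (n + 1) → ι → ℂ) → Matrix ι ι ℂ}, Continuous F →
      Integrable (fun ω : Fin (n + 1) → D => (F fun k => y (ω k)).trace.re) P := fun {F} hF =>
    integrable_continuous_comp (g := fun z => (F z).trace.re) P hym hy
      (Complex.continuous_re.comp hF.matrix_trace)
  have hswap : ∀ F : (Fin (n + 1) → ι → ℂ) → ℝ,
      ∫ ω, F (τ fun k => y (ω k)) ∂P = ∫ ω, F (fun k => y (ω k)) ∂P := fun F => by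
    have h := (measurePreserving_swap μ (Equiv.swap 0 i.succ)).integral_comp
      (MeasurableEquiv.measurableEmbedding _) (fun ω => F fun k => y (ω k))
    simp only [piCongrLeft_const_apply, Equiv.symm_swap] at h
    exact h
  let G : (Fin (n + 1) → ι → ℂ) → ℝ := fun z =>
    ((rankOne (z i.succ) - rankOne (z 0)) * X z ^ (k + 1)).trace.re
  let Q : (Fin (n + 1) → ι → ℂ) → ℝ := fun z =>
    ((rankOne (z i.succ) - rankOne (z 0)) * (rankOne (z i.succ) - rankOne (z 0)) * X z ^ k).trace.re
  let R : (Fin (n + 1) → ι → ℂ) → ℝ := fun z =>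
    ((rankOne (z i.succ) + rankOne (z 0)) * X z ^ k).trace.re
  have hG : Integrable (fun ω => G fun k => y (ω k)) P :=
    hre (((hRc _).sub (hRc _)).matrix_mul (hXc.pow _))
  have hGτ : Integrable (fun ω => G (τ fun k => y (ω k))) P :=
    hre ((((hRc _).sub (hRc _)).matrix_mul (hXc.pow _)).comp hτc)
  have hQ : Integrable (fun ω => Q fun k => y (ω k)) P :=
    hre ((((hRc _).sub (hRc _)).matrix_mul ((hRc _).sub (hRc _))).matrix_mul (hXc.pow _))
  have hQτ : Integrable (fun ω => Q (τ fun k => y (ω k))) P :=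
    hre (((((hRc _).sub (hRc _)).matrix_mul ((hRc _).sub (hRc _))).matrix_mul
      (hXc.pow _)).comp hτc)
  have hR : Integrable (fun ω => R fun k => y (ω k)) P :=
    hre (((hRc _).add (hRc _)).matrix_mul (hXc.pow _))
  have h1 : ∀ z, G z + G (τ z) ≤ (k + 1) / 2 * (Q z + Q (τ z)) := fun z => by
    have hps : Even k ∨ ((X z).PosSemidef ∧ (X (τ z)).PosSemidef) := by
      rcases hk with h | h
      · exact Or.inl h
      -- The odd exponent `k := 1` excludes the parity alternative and leaves positivity of X∘τ.
      · exact (even_or_posSemidef_shiftedSum (Or.inr h) _).imp_right fun h' =>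
          ⟨h', (even_or_posSemidef_shiftedSum (k := 1) (Or.inr h) _).resolve_left (by simp)⟩
    have := trace_sub_mul_pow_sub_le (isHermitian_shiftedSum c fun k : Fin n => z k.succ)
      (isHermitian_shiftedSum c fun k : Fin n => τ z k.succ) hps
    change ((X z - X (τ z)) * (X z ^ (k + 1) - X (τ z) ^ (k + 1))).trace.re ≤
      (k + 1) / 2 * ((X z - X (τ z)) * (X z - X (τ z)) * (X z ^ k + X (τ z) ^ k)).trace.re at this
    rw [hXτ] at this
    simp only [G, Q, hτ0, hτi]
    have e1 : ((rankOne (z 0) - rankOne (z i.succ)) * X (τ z) ^ (k + 1)) =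
        -((rankOne (z i.succ) - rankOne (z 0)) * X (τ z) ^ (k + 1)) := by noncomm_ring
    have e2 : (rankOne (z 0) - rankOne (z i.succ)) * (rankOne (z 0) - rankOne (z i.succ)) =
        (rankOne (z i.succ) - rankOne (z 0)) * (rankOne (z i.succ) - rankOne (z 0)) := by
      noncomm_ring
    rw [e1, e2, ← Complex.add_re, ← Complex.add_re, ← Matrix.trace_add, ← Matrix.trace_add,
      ← sub_eq_add_neg, ← mul_sub, ← mul_add]
    exact this
  have h2 : ∀ ω : Fin (n + 1) → D, Q (fun k => y (ω k)) ≤ 2 * M * R fun k => y (ω k) :=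
    fun ω => by
      have := trace_mul_re_mono (posSemidef_rankOne_sub_mul_self (hy (ω i.succ)) (hy (ω 0)))
        (posSemidef_pow (isHermitian_shiftedSum c fun k : Fin n => y (ω k.succ))
          (even_or_posSemidef_shiftedSum hk _))
      rw [Matrix.smul_mul, Matrix.trace_smul, smul_eq_mul, Complex.re_ofReal_mul] at this
      exact this
  have h3 := integral_mono (hG.add hGτ) ((hQ.add hQτ).const_mul ((k + 1) / 2 : ℝ))
    fun ω => h1 fun k => y (ω k)
  simp only [Pi.add_apply] at h3
  rw [integral_const_mul, integral_add hG hGτ, integral_add hQ hQτ, hswap G, hswap Q] at h3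
  have h4 := integral_mono hQ (hR.const_mul (2 * M)) h2
  rw [integral_const_mul] at h4
  have h5 : (0 : ℝ) ≤ (k + 1) / 2 := by positivity
  have h6 := mul_le_mul_of_nonneg_left h4 h5
  change ∫ ω, G (fun k => y (ω k)) ∂P ≤ (k + 1) * M * ∫ ω, R (fun k => y (ω k)) ∂P
  linarith

/-- Replacing one sample at a time by an independent copy compares consecutive moments of
`X = ∑ₖ yₖ yₖ* - c`. -/
theorem integral_trace_pow_le {μ : Measure D} [IsProbabilityMeasure μ] {n k : ℕ} {c : ℝ}
    (hym : Measurable y) (hy : ∀ x, ∑ i, ‖y x i‖ ^ 2 ≤ M) (hk : Even k ∨ c = 0)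
    {Λ : Matrix ι ι ℂ} (hΛ : ∀ i j, ∫ x, rankOne (y x) i j ∂μ = Λ i j) :
    ∫ ω : Fin n → D, ((sampleSum (fun k => y (ω k)) - (n : ℂ) • Λ) *
        shiftedSum c (fun k => y (ω k)) ^ (k + 1)).trace.re ∂(Measure.pi fun _ => μ) ≤
      (k + 1) * M * ∫ ω : Fin n → D, ((sampleSum (fun k => y (ω k)) + (n : ℂ) • Λ) *
        shiftedSum c (fun k => y (ω k)) ^ k).trace.re ∂(Measure.pi fun _ => μ) := by
  let X : (Fin n → ι → ℂ) → Matrix ι ι ℂ := shiftedSum c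
  have hXc : Continuous X := continuous_shiftedSum c
  have hint : ∀ (i : Fin (n + 1)) (r : ℕ), Integrable (fun ω : Fin (n + 1) → D =>
      (rankOne (y (ω i)) * X (fun k => y (ω k.succ)) ^ r).trace.re) (Measure.pi fun _ => μ) :=
    fun i r => integrable_continuous_comp
      (g := fun z => (rankOne (z i) * X (fun k => z k.succ) ^ r).trace.re) _ hym hy
      (Complex.continuous_re.comp ((continuous_rankOne.comp (continuous_apply i)).matrix_mul
        ((hXc.comp (by fun_prop)).pow r)).matrix_trace)
  have hintS : ∀ r : ℕ, Integrable (fun ω : Fin n → D =>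
      (sampleSum (fun k => y (ω k)) * X (fun k => y (ω k)) ^ r).trace.re)
      (Measure.pi fun _ => μ) := fun r => integrable_continuous_comp
    (g := fun z => (sampleSum z * X z ^ r).trace.re) _ hym hy
      (Complex.continuous_re.comp (continuous_sampleSum.matrix_mul (hXc.pow r)).matrix_trace)
  have hintΛ : ∀ r : ℕ, Integrable (fun ω : Fin n → D =>
      (Λ * X (fun k => y (ω k)) ^ r).trace.re)
      (Measure.pi fun _ => μ) := fun r => integrable_continuous_comp
    (g := fun z => (Λ * X z ^ r).trace.re) _ hym hy
      (Complex.continuous_re.comp (continuous_const.matrix_mul (hXc.pow r)).matrix_trace)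
  -- Sample `0` does not occur in these integrands, so it is integrated away; summing over `i`
  -- rebuilds `sampleSum`.
  have hS : ∀ r : ℕ, ∑ i : Fin n, ∫ ω : Fin (n + 1) → D,
      (rankOne (y (ω i.succ)) * X (fun k => y (ω k.succ)) ^ r).trace.re ∂(Measure.pi fun _ => μ) =
      ∫ ω : Fin n → D, (sampleSum (fun k => y (ω k)) * X (fun k => y (ω k)) ^ r).trace.re
        ∂(Measure.pi fun _ => μ) := fun r => by
    rw [← integral_finsetSum _ fun i _ => hint i.succ r,
      ← (measurePreserving_tail μ n).map_eq, integral_map]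
    · refine integral_congr_ae (Filter.Eventually.of_forall fun ω => ?_)
      simp only [sampleSum, Finset.sum_mul, Matrix.trace_sum, Complex.re_sum]
    · exact (measurePreserving_tail μ n).measurable.aemeasurable
    · rw [(measurePreserving_tail μ n).map_eq]
      exact (hintS r).aestronglyMeasurable
  have h0 : ∀ r : ℕ, ∫ ω : Fin (n + 1) → D,
      (rankOne (y (ω 0)) * X (fun k => y (ω k.succ)) ^ r).trace.re ∂(Measure.pi fun _ => μ) =
      ∫ ω : Fin n → D, (Λ * X (fun k => y (ω k)) ^ r).trace.re ∂(Measure.pi fun _ => μ) :=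
    fun r => integral_trace_rankOne_mul hym hy hΛ (A := fun z => X z ^ r) (hXc.pow r)
  have h1 := Finset.sum_le_sum fun (i : Fin n) (_ : i ∈ Finset.univ) =>
    integral_trace_sub_mul_pow_le (μ := μ) hym hy hk i
  change ∑ i : Fin n, ∫ ω : Fin (n + 1) → D, ((rankOne (y (ω i.succ)) - rankOne (y (ω 0))) *
        X (fun k => y (ω k.succ)) ^ (k + 1)).trace.re ∂(Measure.pi fun _ => μ) ≤
    ∑ i : Fin n, (k + 1) * M * ∫ ω : Fin (n + 1) → D,
      ((rankOne (y (ω i.succ)) + rankOne (y (ω 0))) *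
        X (fun k => y (ω k.succ)) ^ k).trace.re ∂(Measure.pi fun _ => μ) at h1
  rw [← Finset.mul_sum] at h1
  simp only [sub_mul, add_mul, Matrix.trace_sub, Matrix.trace_add, Complex.sub_re,
    Complex.add_re] at h1
  simp_rw [integral_sub (hint _ _) (hint _ _), integral_add (hint _ _) (hint _ _), h0] at h1
  rw [Finset.sum_sub_distrib, Finset.sum_add_distrib, hS, hS, Finset.sum_const, Finset.sum_const,
    Finset.card_univ, Fintype.card_fin, nsmul_eq_mul, nsmul_eq_mul] at h1
  have e : ∀ B : Matrix ι ι ℂ, (((n : ℂ) • Λ) * B).trace.re = n * (Λ * B).trace.re := fun B => by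
    rw [Matrix.smul_mul, Matrix.trace_smul, smul_eq_mul, ← Complex.ofReal_natCast,
      Complex.re_ofReal_mul]
  simp only [sub_mul, add_mul, Matrix.trace_sub, Matrix.trace_add, Complex.sub_re,
    Complex.add_re, e]
  rw [integral_sub (hintS _) ((hintΛ _).const_mul _), integral_add (hintS _)
    ((hintΛ _).const_mul _), integral_const_mul, integral_const_mul]
  exact h1

end Exchange


/-! ### Eigenvalue tail bounds by the moment method -/

section TailBounds

open scoped ComplexOrder MatrixOrder

variable {ι : Type*} [Fintype ι]

theorem dotProduct_rankOne_mulVec (u v : ι → ℂ) :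
    star v ⬝ᵥ (rankOne u *ᵥ v) = ((‖star u ⬝ᵥ v‖ ^ 2 : ℝ) : ℂ) := by
  rw [rankOne, Matrix.vecMulVec_mulVec, dotProduct_smul]
  push_cast
  rw [← Complex.mul_conj', op_smul_eq_smul, smul_eq_mul, starRingEnd_apply,
    Matrix.star_dotProduct, star_star]

theorem dotProduct_sampleSum_mulVec {n : ℕ} (z : Fin n → ι → ℂ) (v : ι → ℂ) :
    star v ⬝ᵥ (sampleSum z *ᵥ v) = ((∑ k, ‖star (z k) ⬝ᵥ v‖ ^ 2 : ℝ) : ℂ) := by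
  rw [sampleSum, Matrix.sum_mulVec, dotProduct_sum]
  simp only [dotProduct_rankOne_mulVec]
  push_cast
  rfl

theorem star_dotProduct_self (v : ι → ℂ) : star v ⬝ᵥ v = ((∑ i, ‖v i‖ ^ 2 : ℝ) : ℂ) := by
  push_cast
  exact Finset.sum_congr rfl fun i _ => Complex.conj_mul' _

variable [DecidableEq ι]

/-- Under either alternative the trace of A^p is the sum of the |eigenvalue|^p, which dominates each
single term. -/
theorem abs_eigenvalues_le {A : Matrix ι ι ℂ} {p : ℕ} {s : ℝ} (hA : A.IsHermitian) (hs : 0 ≤ s)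
    (hp : Even p ∨ A.PosSemidef) (h : (A ^ p).trace.re < s ^ p) (i : ι) :
    |hA.eigenvalues i| ≤ s := by
  have h1 : (A ^ p).trace.re = ∑ i, |hA.eigenvalues i| ^ p := by
    rw [pow_eq_conj_diagonal hA, Matrix.trace_mul_comm, ← Matrix.mul_assoc,
      ← Matrix.star_eq_conjTranspose, Unitary.coe_star_mul_self, one_mul, Matrix.trace_diagonal,
      Complex.re_sum]
    refine Finset.sum_congr rfl fun i _ => ?_
    rw [Complex.ofReal_re]
    rcases hp with hp | hp
    · rw [hp.pow_abs]
    · rw [abs_of_nonneg (hp.eigenvalues_nonneg i)]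
  by_contra! hlt
  have h2 : |hA.eigenvalues i| ^ p ≤ ∑ i, |hA.eigenvalues i| ^ p :=
    Finset.single_le_sum (f := fun i => |hA.eigenvalues i| ^ p)
      (fun _ _ => pow_nonneg (abs_nonneg _) _) (Finset.mem_univ i)
  exact absurd h (not_lt.2 (((pow_le_pow_left₀ hs hlt.le p).trans h2).trans_eq h1.symm))

theorem posSemidef_smul_one_add_smul {A : Matrix ι ι ℂ} (hA : A.IsHermitian) {s r : ℝ}
    (h : ∀ i, 0 ≤ s + r * hA.eigenvalues i) : ((s : ℂ) • 1 + (r : ℂ) • A).PosSemidef := by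
  have e : (s : ℂ) • 1 + (r : ℂ) • A = (hA.eigenvectorUnitary : Matrix ι ι ℂ) *
      Matrix.diagonal (fun i => ((s + r * hA.eigenvalues i : ℝ) : ℂ)) *
      (hA.eigenvectorUnitary : Matrix ι ι ℂ)ᴴ := by
    have e0 := pow_eq_conj_diagonal hA 0
    have e1 := pow_eq_conj_diagonal hA 1
    rw [pow_zero] at e0
    rw [pow_one] at e1
    have e2 : Matrix.diagonal (fun i => ((s + r * hA.eigenvalues i : ℝ) : ℂ)) =
        (s : ℂ) • Matrix.diagonal (fun i => ((hA.eigenvalues i ^ 0 : ℝ) : ℂ)) +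
        (r : ℂ) • Matrix.diagonal (fun i => ((hA.eigenvalues i ^ 1 : ℝ) : ℂ)) := by
      rw [← Matrix.diagonal_smul, ← Matrix.diagonal_smul, Matrix.diagonal_add]
      congr 1
      funext i
      simp
    rw [e2, Matrix.mul_add, Matrix.add_mul, Matrix.mul_smul, Matrix.mul_smul, Matrix.smul_mul,
      Matrix.smul_mul, ← e0, ← e1]
  rw [e]
  refine Matrix.PosSemidef.mul_mul_conjTranspose_same (Matrix.PosSemidef.diagonal fun i => ?_) _
  exact Complex.zero_le_real.2 (h i)

variable {D : Type*} [MeasurableSpace D] {y : D → ι → ℂ} {M : ℝ}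

theorem integrable_trace_pow {n : ℕ} {P : Measure (Fin n → D)} [IsFiniteMeasure P]
    (hym : Measurable y) (hy : ∀ x, ∑ i, ‖y x i‖ ^ 2 ≤ M) (c : ℝ) (B : Matrix ι ι ℂ) (p : ℕ) :
    Integrable (fun ω : Fin n → D => (B * shiftedSum c (fun k => y (ω k)) ^ p).trace.re) P :=
  integrable_continuous_comp (g := fun z : Fin n → ι → ℂ => (B * shiftedSum c z ^ p).trace.re)
    P hym hy (Complex.continuous_re.comp
      (continuous_const.matrix_mul ((continuous_shiftedSum c).pow p)).matrix_trace)

theorem measureReal_le_trace_pow {n : ℕ} {P : Measure (Fin n → D)} [IsFiniteMeasure P]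
    (hym : Measurable y) (hy : ∀ x, ∑ i, ‖y x i‖ ^ 2 ≤ M) {c s : ℝ} {p : ℕ} (hs : 0 < s)
    (hp : Even p ∨ c = 0) :
    P.real {ω | s ^ p ≤ (shiftedSum c (fun k => y (ω k)) ^ p).trace.re} ≤
      (∫ ω, (shiftedSum c (fun k => y (ω k)) ^ p).trace.re ∂P) / s ^ p := by
  have hint := integrable_trace_pow (P := P) hym hy c 1 p
  simp only [one_mul] at hint
  have hnn : ∀ ω : Fin n → D, 0 ≤ (shiftedSum c (fun k => y (ω k)) ^ p).trace.re := fun ω =>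
    (Complex.le_def.1 (posSemidef_pow (isHermitian_shiftedSum c fun k => y (ω k))
      (even_or_posSemidef_shiftedSum hp fun k => y (ω k))).trace_nonneg).1
  have h := mul_meas_ge_le_integral_of_nonneg (Filter.Eventually.of_forall hnn) hint (s ^ p)
  rw [le_div_iff₀ (pow_pos hs p), mul_comm]
  exact h

section Upper

variable {μ : Measure D} [IsProbabilityMeasure μ] {l : ι → ℝ}

theorem integral_trace_sampleSum (hym : Measurable y) (hy : ∀ x, ∑ i, ‖y x i‖ ^ 2 ≤ M)
    {Λ : Matrix ι ι ℂ} (hΛ : ∀ i j, ∫ x, rankOne (y x) i j ∂μ = Λ i j) (n : ℕ) :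
    ∫ ω : Fin n → D, (sampleSum (fun k => y (ω k))).trace.re ∂(Measure.pi fun _ => μ) =
      n * Λ.trace.re := by
  have h1 : ∀ k : Fin n, ∫ ω : Fin n → D, (rankOne (y (ω k))).trace.re
      ∂(Measure.pi fun _ => μ) = Λ.trace.re := fun k => by
    have h2 := integral_trace_mul hym hy hΛ 1
    simp only [mul_one] at h2
    have h3 := measurePreserving_eval (fun _ : Fin n => μ) k
    have h4 : Measurable fun x => (rankOne (y x)).trace.re :=
      (Complex.continuous_re.comp continuous_rankOne.matrix_trace).measurable.comp hym
    have h5 := integral_map (μ := Measure.pi fun _ : Fin n => μ) h3.measurable.aemeasurable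
      h4.aestronglyMeasurable
    rw [h3.map_eq, h2] at h5
    exact h5.symm
  have hint : ∀ k : Fin n, Integrable (fun ω : Fin n → D => (rankOne (y (ω k))).trace.re)
      (Measure.pi fun _ => μ) := fun k =>
    integrable_continuous_comp (g := fun z : Fin n → ι → ℂ => (rankOne (z k)).trace.re) _ hym hy
      (Complex.continuous_re.comp (continuous_rankOne.comp (continuous_apply k)).matrix_trace)
  simp only [sampleSum, Matrix.trace_sum, Complex.re_sum]
  rw [integral_finsetSum _ fun k _ => hint k]
  simp [h1]

/-- Let t_q and u_q be the means of tr S^q and tr(nΛ S^q). For c = 0 the exchange bound reads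
t_{k+2} ≤ u_{k+1} + (k+1)M(t_{k+1} + u_k), and nΛ ≤ R gives u_q ≤ R t_q. The trace of Λ enters only
through t_1, so no factor `Fintype.card ι` appears. -/
theorem integral_trace_pow_le_of_diagonal {n p : ℕ} {R T : ℝ} (hym : Measurable y)
    (hy : ∀ x, ∑ i, ‖y x i‖ ^ 2 ≤ M)
    (hΛ : ∀ i j, ∫ x, rankOne (y x) i j ∂μ = Matrix.diagonal (fun i => (l i : ℂ)) i j)
    (hR : 0 ≤ R) (hM : 0 ≤ M) (hlR : ∀ i, n * l i ≤ R) (hlT : ∑ i, l i ≤ T)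
    (hMR : p * M ≤ 2 * R) (hMR' : 2 * M ≤ 3 * R) :
    ∫ ω : Fin n → D, (sampleSum (fun k => y (ω k)) ^ (p + 1)).trace.re
      ∂(Measure.pi fun _ => μ) ≤ (4 * R) ^ p * (n * T) := by
  set P : Measure (Fin n → D) := Measure.pi fun _ => μ
  set Λ : Matrix ι ι ℂ := Matrix.diagonal fun i => (l i : ℂ)
  let t : ℕ → ℝ := fun q => ∫ ω : Fin n → D, (sampleSum (fun k => y (ω k)) ^ q).trace.re ∂P
  let u : ℕ → ℝ := fun q => ∫ ω : Fin n → D,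
    (((n : ℂ) • Λ) * sampleSum (fun k => y (ω k)) ^ q).trace.re ∂P
  have hint : ∀ (B : Matrix ι ι ℂ) (q : ℕ), Integrable
      (fun ω : Fin n → D => (B * sampleSum (fun k => y (ω k)) ^ q).trace.re) P := fun B q => by
    have := integrable_trace_pow (P := P) hym hy 0 B q
    simpa only [shiftedSum_zero] using this
  have hint1 : ∀ q : ℕ, Integrable
      (fun ω : Fin n → D => (sampleSum (fun k => y (ω k)) ^ q).trace.re) P := fun q => by
    simpa only [one_mul] using hint 1 q
  have htr : Λ.trace.re = ∑ i, l i := by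
    simp [Λ, Matrix.trace_diagonal]
  have ht1 : t 1 ≤ n * T := by
    have := integral_trace_sampleSum (μ := μ) hym hy hΛ n
    simp only [t, pow_one]
    rw [this, htr]
    gcongr
  have ht1' : t 1 = u 0 := by
    have := integral_trace_sampleSum (μ := μ) hym hy hΛ n
    simp only [t, u, pow_one, pow_zero, mul_one]
    rw [this, integral_const, Matrix.trace_smul]
    simp [P]
  have ht0 : ∀ q, 0 ≤ t q := fun q => integral_nonneg fun ω =>
    (Complex.le_def.1 ((posSemidef_sampleSum fun k => y (ω k)).pow q).trace_nonneg).1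
  have hu : ∀ q, u q ≤ R * t q := fun q => by
    rw [← integral_const_mul]
    refine integral_mono (hint _ q) ((hint1 q).const_mul R) fun ω => ?_
    have h1 : (((R : ℂ) • 1) - (n : ℂ) • Λ).PosSemidef := by
      have : ((R : ℂ) • 1) - (n : ℂ) • Λ = Matrix.diagonal fun i => ((R - n * l i : ℝ) : ℂ) := by
        ext i j
        by_cases h : i = j
        · subst h; simp [Λ]
        · simp [Λ, h]
      rw [this]
      exact Matrix.PosSemidef.diagonal fun i => Complex.zero_le_real.2 (sub_nonneg.2 (hlR i))
    have h2 := trace_mul_re_mono h1 ((posSemidef_sampleSum fun k => y (ω k)).pow q)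
    rwa [Matrix.smul_mul (R : ℂ), one_mul, Matrix.trace_smul, smul_eq_mul,
      Complex.re_ofReal_mul] at h2
  have hrec : ∀ k, t (k + 2) ≤ u (k + 1) + (k + 1) * M * (t (k + 1) + u k) := fun k => by
    have h := integral_trace_pow_le (μ := μ) (n := n) (k := k) (c := 0) hym hy (Or.inr rfl) hΛ
    generalize ((k : ℝ) + 1) * M = κ at h ⊢
    simp only [shiftedSum_zero, sub_mul, add_mul, Matrix.trace_sub, Matrix.trace_add,
      Complex.sub_re, Complex.add_re, ← pow_succ'] at h
    rw [integral_sub (hint1 _) (hint _ _), integral_add (hint1 _) (hint _ _)] at h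
    change t (k + 2) - u (k + 1) ≤ κ * (t (k + 1) + u k) at h
    linarith
  -- The recursion reaches back two steps, so the induction carries two consecutive moments.
  have main : ∀ q, q ≤ p → t (q + 1) ≤ (4 * R) ^ q * (n * T) ∧
      (q + 1 ≤ p → t (q + 2) ≤ (4 * R) ^ (q + 1) * (n * T)) := by
    have hMk : ∀ k : ℕ, k + 1 ≤ p → ((k : ℝ) + 1) * M ≤ 2 * R := fun k hk => by
      refine le_trans ?_ hMR
      gcongr
      exact_mod_cast hk
    intro q
    induction q with
    | zero =>
      refine fun _ => ⟨by simpa using ht1, fun h => ?_⟩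
      have h1 := hrec 0
      rw [← ht1'] at h1
      have h2 := hu 1
      simp only [Nat.cast_zero, zero_add, one_mul, pow_one] at h1 ⊢
      have h4 : 0 ≤ t 1 := ht0 1
      -- Since u_0 = t_1, the recursion gives t_2 ≤ (R + 2M) t_1 ≤ 4R t_1.
      nlinarith [mul_le_mul_of_nonneg_right hMR' h4,
        mul_le_mul_of_nonneg_left ht1 (by positivity : 0 ≤ 4 * R)]
    | succ q ih =>
      intro hq
      have ih' := ih (by omega)
      refine ⟨ih'.2 hq, fun hq2 => ?_⟩
      have h1 := hrec (q + 1)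
      have h2 := hMk (q + 1) hq2
      have hu1 := hu (q + 2)
      have hu2 := hu (q + 1)
      set A := (4 * R) ^ q * (n * T)
      have hA1 : t (q + 1) ≤ A := ih'.1
      have hA2 : t (q + 2) ≤ 4 * R * A := by
        have := ih'.2 hq
        rw [pow_succ] at this
        linarith
      have hA3 : (4 * R) ^ (q + 1 + 1) * (n * T) = 16 * R ^ 2 * A := by
        simp only [A]; ring
      rw [hA3]
      have h5 : t (q + 1 + 1) + u (q + 1) ≤ 5 * R * A := by
        have : R * t (q + 1) ≤ R * A := mul_le_mul_of_nonneg_left hA1 hR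
        have e : t (q + 1 + 1) = t (q + 2) := rfl
        linarith
      have h6 : (((q + 1 : ℕ) : ℝ) + 1) * M * (t (q + 1 + 1) + u (q + 1)) ≤
          2 * R * (5 * R * A) := by
        have h7 : 0 ≤ (((q + 1 : ℕ) : ℝ) + 1) * M := by positivity
        have h8 : 0 ≤ 5 * R * A := by
          have : 0 ≤ A := (ht0 _).trans hA1
          positivity
        exact (mul_le_mul_of_nonneg_left h5 h7).trans (mul_le_mul_of_nonneg_right h2 h8)
      have h9 : R * t (q + 2) ≤ R * (4 * R * A) := mul_le_mul_of_nonneg_left hA2 hR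
      have e : u (q + 1 + 1) = u (q + 2) := rfl
      have h10 : 0 ≤ R ^ 2 * A := by
        have : 0 ≤ A := (ht0 _).trans hA1
        positivity
      -- The total 14 R²A stays below the required 16 R²A.
      have e2 : t (q + 1 + 2) ≤ R * (4 * R * A) + 2 * R * (5 * R * A) := by linarith
      refine e2.trans ?_
      nlinarith
  exact (main p le_rfl).1

/-- An upper tail bound for the largest eigenvalue of a sum of independent random matrices of
rank one. -/
theorem measureReal_upper_tail_le {n p : ℕ} {R T s : ℝ} (hym : Measurable y)
    (hy : ∀ x, ∑ i, ‖y x i‖ ^ 2 ≤ M)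
    (hΛ : ∀ i j, ∫ x, rankOne (y x) i j ∂μ = Matrix.diagonal (fun i => (l i : ℂ)) i j)
    (hR : 0 ≤ R) (hM : 0 ≤ M) (hs : 0 < s) (hlR : ∀ i, n * l i ≤ R) (hlT : ∑ i, l i ≤ T)
    (hMR : p * M ≤ 2 * R) (hMR' : 2 * M ≤ 3 * R) :
    (Measure.pi fun _ : Fin n => μ).real
      {ω | ∃ v : ι → ℂ, s * ∑ i, ‖v i‖ ^ 2 < ∑ k, ‖star (y (ω k)) ⬝ᵥ v‖ ^ 2} ≤
      (4 * R) ^ p * (n * T) / s ^ (p + 1) := by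
  have h1 := measureReal_le_trace_pow (P := Measure.pi fun _ : Fin n => μ) (p := p + 1) hym hy hs
    (Or.inr rfl)
  refine (measureReal_mono ?_ (measure_ne_top _ _)).trans (h1.trans ?_)
  · rintro ω ⟨v, hv⟩
    by_contra hω
    rw [Set.mem_ofPred_eq, not_le, shiftedSum_zero] at hω
    have hps := posSemidef_sampleSum fun k => y (ω k)
    have h2 := abs_eigenvalues_le hps.1 hs.le (Or.inr hps) hω
    have h3 := (posSemidef_smul_one_add_smul (r := -1) (s := s) hps.1
      fun i => by linarith [le_abs_self (hps.1.eigenvalues i), h2 i]).dotProduct_mulVec_nonneg v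
    rw [Matrix.add_mulVec, Matrix.smul_mulVec, Matrix.smul_mulVec, dotProduct_add,
      dotProduct_smul, dotProduct_smul, Matrix.one_mulVec, dotProduct_sampleSum_mulVec,
      star_dotProduct_self, smul_eq_mul, smul_eq_mul] at h3
    rw [← Complex.ofReal_mul, ← Complex.ofReal_mul, ← Complex.ofReal_add,
      Complex.zero_le_real] at h3
    linarith
  · simp only [shiftedSum_zero]
    gcongr
    exact integral_trace_pow_le_of_diagonal hym hy hΛ hR hM hlR hlT hMR hMR'

end Upper

section Lower

variable {μ : Measure D} [IsProbabilityMeasure μ]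

/-- Here Λ = 1 and c = n, so that S - nΛ = X and S + nΛ = X + 2n. The exchange bound with even
exponent links consecutive even moments through the odd one between them, which `hmid` eliminates.
-/
theorem integral_trace_shiftedSum_pow_le {n p : ℕ} (hn : 0 < n) (hym : Measurable y)
    (hy : ∀ x, ∑ i, ‖y x i‖ ^ 2 ≤ M) (hM : 0 ≤ M)
    (hΛ : ∀ i j, ∫ x, rankOne (y x) i j ∂μ = (1 : Matrix ι ι ℂ) i j)
    (hMn : 2 * p * M ≤ n / 24) :
    ∫ ω : Fin n → D, (shiftedSum n (fun k => y (ω k)) ^ (2 * p)).trace.re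
      ∂(Measure.pi fun _ => μ) ≤ (5 / 47 * (n : ℝ) ^ 2) ^ p * Fintype.card ι := by
  set P : Measure (Fin n → D) := Measure.pi fun _ => μ
  let t : ℕ → ℝ := fun q => ∫ ω : Fin n → D, (shiftedSum n (fun k => y (ω k)) ^ q).trace.re ∂P
  have hn' : (0 : ℝ) < n := by exact_mod_cast hn
  have hint1 : ∀ q : ℕ, Integrable
      (fun ω : Fin n → D => (shiftedSum n (fun k => y (ω k)) ^ q).trace.re) P := fun q => by
    simpa only [one_mul] using integrable_trace_pow (P := P) hym hy n 1 q
  -- This is (x - n)² x^(2q) ≥ 0 on the spectrum of X, divided by 2n.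
  have hmid : ∀ q, t (2 * q + 1) ≤ 1 / (2 * n) * t (2 * q + 2) + n / 2 * t (2 * q) := fun q => by
    simp only [t]
    rw [← integral_const_mul, ← integral_const_mul, ← integral_add ((hint1 _).const_mul _)
      ((hint1 _).const_mul _)]
    refine integral_mono (hint1 _) (((hint1 _).const_mul _).add ((hint1 _).const_mul _))
      fun ω => ?_
    set X := shiftedSum n fun k => y (ω k)
    have hX : X.IsHermitian := isHermitian_shiftedSum _ _
    have hXn : (X - (n : ℂ) • 1).IsHermitian := hX.sub (by
      rw [Matrix.IsHermitian, Matrix.conjTranspose_smul, Matrix.conjTranspose_one]; simp)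
    have h := trace_mul_re_nonneg (posSemidef_pow hXn (Or.inl even_two))
      (posSemidef_pow hX (k := 2 * q) (Or.inl (even_two_mul q)))
    have e : (X - (n : ℂ) • 1) ^ 2 * X ^ (2 * q) = X ^ (2 * q + 2) - ((2 * n : ℝ) : ℂ) •
        X ^ (2 * q + 1) + ((n ^ 2 : ℝ) : ℂ) • X ^ (2 * q) := by
      rw [sq, sub_mul, mul_sub, mul_sub, pow_succ' X (2 * q + 1), pow_succ' X (2 * q)]
      simp only [Matrix.smul_mul, Matrix.mul_smul, one_mul, mul_one, sub_mul, ← mul_assoc]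
      push_cast
      module
    rw [e, Matrix.trace_add, Matrix.trace_sub, Matrix.trace_smul, Matrix.trace_smul,
      Complex.add_re, Complex.sub_re, smul_eq_mul, smul_eq_mul, Complex.re_ofReal_mul,
      Complex.re_ofReal_mul] at h
    have h' := mul_le_mul_of_nonneg_left h (by positivity : (0 : ℝ) ≤ 1 / (2 * n))
    have e' : 1 / (2 * (n : ℝ)) * ((X ^ (2 * q + 2)).trace.re - 2 * n * (X ^ (2 * q + 1)).trace.re +
        n ^ 2 * (X ^ (2 * q)).trace.re) = 1 / (2 * n) * (X ^ (2 * q + 2)).trace.re -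
        (X ^ (2 * q + 1)).trace.re + n / 2 * (X ^ (2 * q)).trace.re := by
      field_simp
    change (X ^ (2 * q + 1)).trace.re ≤ 1 / (2 * n) * (X ^ (2 * q + 2)).trace.re +
      n / 2 * (X ^ (2 * q)).trace.re
    linarith
  have hrec : ∀ q, t (2 * q + 2) ≤ (2 * q + 1) * M * (t (2 * q + 1) + 2 * n * t (2 * q)) :=
    fun q => by
      have h := integral_trace_pow_le (μ := μ) (n := n) (k := 2 * q) (c := n) hym hy
        (Or.inl (even_two_mul q)) hΛ
      push_cast at h
      generalize (2 * (q : ℝ) + 1) * M = κ at h ⊢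
      have e1 : ∀ z : Fin n → ι → ℂ, sampleSum z - (n : ℂ) • 1 = shiftedSum n z := fun z => by
        rw [shiftedSum, Complex.ofReal_natCast]
      have e2 : ∀ z : Fin n → ι → ℂ, sampleSum z + (n : ℂ) • 1 =
          shiftedSum n z + ((2 * n : ℝ) : ℂ) • 1 := fun z => by
        rw [shiftedSum]
        push_cast
        module
      simp only [e1, e2, add_mul, ← pow_succ', Matrix.smul_mul, one_mul, Matrix.trace_add,
        Complex.add_re, Matrix.trace_smul, smul_eq_mul, Complex.re_ofReal_mul] at h
      rw [integral_add (hint1 _) ((hint1 _).const_mul _), integral_const_mul] at h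
      exact h
  have ht0 : ∀ q, 0 ≤ t (2 * q) := fun q => integral_nonneg fun ω =>
    (Complex.le_def.1 (posSemidef_pow (isHermitian_shiftedSum (n : ℝ) fun k => y (ω k))
      (Or.inl (even_two_mul q))).trace_nonneg).1
  have main : ∀ q, q ≤ p → t (2 * q) ≤ (5 / 47 * (n : ℝ) ^ 2) ^ q * Fintype.card ι := by
    intro q
    induction q with
    | zero => intro _; simp [t, P, Matrix.trace_one]
    | succ q ih =>
      intro hq
      have ih' := ih (by omega)
      have h1 := hrec q
      have h2 := hmid q
      have hκ : (2 * (q : ℝ) + 1) * M ≤ n / 24 := by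
        refine le_trans ?_ hMn
        have : (q : ℝ) + 1 ≤ p := by exact_mod_cast hq
        gcongr
        linarith
      have h3 : t (2 * q + 1) + 2 * n * t (2 * q) ≤
          1 / (2 * n) * t (2 * q + 2) + 5 / 2 * n * t (2 * q) := by linarith
      have h4 : 0 ≤ 1 / (2 * n) * t (2 * q + 2) + 5 / 2 * n * t (2 * q) := by
        have := ht0 q
        have : 0 ≤ t (2 * q + 2) := ht0 (q + 1)
        positivity
      have h5 : t (2 * q + 2) ≤ n / 24 * (1 / (2 * n) * t (2 * q + 2) + 5 / 2 * n * t (2 * q)) :=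
        h1.trans ((mul_le_mul_of_nonneg_left h3 (by positivity)).trans
          (mul_le_mul_of_nonneg_right hκ h4))
      have h6 : (n : ℝ) / 24 * (1 / (2 * n) * t (2 * q + 2) + 5 / 2 * n * t (2 * q)) =
          1 / 48 * t (2 * q + 2) + 5 / 48 * n ^ 2 * t (2 * q) := by
        field_simp
        ring
      -- The term t/48 is absorbed on the left: (5/48)/(47/48) = 5/47.
      have h7 : t (2 * q + 2) ≤ 5 / 47 * (n : ℝ) ^ 2 * t (2 * q) := by linarith
      calc t (2 * (q + 1)) = t (2 * q + 2) := rfl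
        _ ≤ 5 / 47 * (n : ℝ) ^ 2 * t (2 * q) := h7
        _ ≤ 5 / 47 * (n : ℝ) ^ 2 * ((5 / 47 * (n : ℝ) ^ 2) ^ q * Fintype.card ι) := by gcongr
        _ = _ := by ring
  exact main p le_rfl

/-- A lower tail bound for the smallest eigenvalue of a sum of independent random matrices of
rank one. -/
theorem measureReal_lower_tail_le {n p : ℕ} (hn : 0 < n) (hym : Measurable y)
    (hy : ∀ x, ∑ i, ‖y x i‖ ^ 2 ≤ M) (hM : 0 ≤ M)
    (hΛ : ∀ i j, ∫ x, rankOne (y x) i j ∂μ = (1 : Matrix ι ι ℂ) i j)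
    (hMn : 2 * p * M ≤ n / 24) :
    (Measure.pi fun _ : Fin n => μ).real
      {ω | ∃ v : ι → ℂ, ∑ k, ‖star (y (ω k)) ⬝ᵥ v‖ ^ 2 < n / 4 * ∑ i, ‖v i‖ ^ 2} ≤
      (80 / 423) ^ p * Fintype.card ι := by
  have hn' : (0 : ℝ) < n := by exact_mod_cast hn
  -- Eigenvalues of S - n of modulus at most 3n/4 leave S ≥ n/4; Markov's inequality then produces
  -- (5/47)/(3/4)² = 80/423 per two powers.
  have hs : (0 : ℝ) < 3 / 4 * n := by positivity
  have h1 := measureReal_le_trace_pow (P := Measure.pi fun _ : Fin n => μ) (p := 2 * p)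
    (c := n) hym hy hs (Or.inl (even_two_mul p))
  refine (measureReal_mono ?_ (measure_ne_top _ _)).trans (h1.trans ?_)
  · rintro ω ⟨v, hv⟩
    by_contra hω
    rw [Set.mem_ofPred_eq, not_le] at hω
    have hX := isHermitian_shiftedSum (n : ℝ) fun k => y (ω k)
    have h2 := abs_eigenvalues_le hX hs.le (Or.inl (even_two_mul p)) hω
    have h3 := (posSemidef_smul_one_add_smul (r := 1) (s := 3 / 4 * n) hX
      fun i => by linarith [neg_abs_le (hX.eigenvalues i), h2 i]).dotProduct_mulVec_nonneg v
    have e : ((3 / 4 * n : ℝ) : ℂ) • 1 + ((1 : ℝ) : ℂ) • shiftedSum n (fun k => y (ω k)) =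
        sampleSum (fun k => y (ω k)) - ((n / 4 : ℝ) : ℂ) • 1 := by
      rw [shiftedSum]
      push_cast
      module
    rw [e, Matrix.sub_mulVec, Matrix.smul_mulVec, dotProduct_sub, dotProduct_smul,
      Matrix.one_mulVec, dotProduct_sampleSum_mulVec, star_dotProduct_self, smul_eq_mul] at h3
    rw [← Complex.ofReal_mul, ← Complex.ofReal_sub, Complex.zero_le_real] at h3
    linarith
  · rw [div_le_iff₀ (by positivity)]
    refine (integral_trace_shiftedSum_pow_le hn hym hy hM hΛ hMn).trans_eq ?_
    rw [pow_mul (3 / 4 * (n : ℝ)), mul_right_comm, ← mul_pow]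
    congr 2
    ring

end Lower

end TailBounds


/-! ### Orthonormal systems -/

section Orthonormal

variable {H : Type*} [NormedAddCommGroup H] [InnerProductSpace ℂ H]

theorem norm_sub_sum_inner_smul_sq {κ : Type*} {b : κ → H} (hb : Orthonormal ℂ b) (F : Finset κ)
    (f : H) : ‖f - ∑ i ∈ F, ⟪b i, f⟫_ℂ • b i‖ ^ 2 = ‖f‖ ^ 2 - ∑ i ∈ F, ‖⟪b i, f⟫_ℂ‖ ^ 2 := by
  set u := ∑ i ∈ F, ⟪b i, f⟫_ℂ • b i
  have h1 : ⟪u, f⟫_ℂ = ((∑ i ∈ F, ‖⟪b i, f⟫_ℂ‖ ^ 2 : ℝ) : ℂ) := by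
    simp only [u, sum_inner, inner_smul_left]
    push_cast
    exact Finset.sum_congr rfl fun i _ => Complex.conj_mul' _
  have h2 : ⟪u, u⟫_ℂ = ((∑ i ∈ F, ‖⟪b i, f⟫_ℂ‖ ^ 2 : ℝ) : ℂ) := by
    simp only [u]
    rw [hb.inner_sum]
    push_cast
    exact Finset.sum_congr rfl fun i _ => Complex.conj_mul' _
  have h3 : ‖u‖ ^ 2 = ∑ i ∈ F, ‖⟪b i, f⟫_ℂ‖ ^ 2 := by
    rw [inner_self_eq_norm_sq_to_K] at h2
    exact Complex.ofReal_injective (by simpa using h2)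
  have h4 := norm_sub_sq (𝕜 := ℂ) f u
  have h5 : RCLike.re ⟪f, u⟫_ℂ = ∑ i ∈ F, ‖⟪b i, f⟫_ℂ‖ ^ 2 := by
    rw [inner_re_symm, h1]
    exact Complex.ofReal_re _
  rw [h4, h5, h3]
  ring

theorem countable_of_orthonormal [TopologicalSpace.SeparableSpace H] {κ : Type*} {b : κ → H}
    (hb : Orthonormal ℂ b) : Countable κ := by
  have h := Set.PairwiseDisjoint.countable_of_isOpen (s := fun i : κ => Metric.ball (b i) (1 / 2))
    (a := Set.univ) ?_ (fun i _ => Metric.isOpen_ball)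
    (fun i _ => ⟨b i, Metric.mem_ball_self (by norm_num)⟩)
  · exact Set.countable_univ_iff.1 h
  · intro i _ j _ hij
    refine Metric.ball_disjoint_ball ?_
    have h1 := norm_sub_sq (𝕜 := ℂ) (b i) (b j)
    rw [hb.2 hij, hb.1 i, hb.1 j] at h1
    rw [dist_eq_norm]
    simp only [map_zero] at h1
    nlinarith [norm_nonneg (b i - b j)]

end Orthonormal

/-! ### The kernel and compactness of the embedding -/

section Embedding

variable {D : Type*} {H : Type*}
  [NormedAddCommGroup H] [InnerProductSpace ℂ H] [CompleteSpace H] [RKHS ℂ H D ℂ]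

/-- The section `K(·, x)` of the kernel. -/
def kernelSection (H : Type*) [NormedAddCommGroup H] [InnerProductSpace ℂ H] [CompleteSpace H]
    [RKHS ℂ H D ℂ] (x : D) : H := RKHS.kerFun H x (1 : ℂ)

theorem inner_kernelSection (x : D) (f : H) : ⟪kernelSection H x, f⟫_ℂ = f x := by
  simp [kernelSection]

theorem inner_kernelSection' (x : D) (f : H) :
    ⟪f, kernelSection H x⟫_ℂ = starRingEnd ℂ (f x) := by
  rw [← inner_conj_symm, inner_kernelSection]

theorem kernelDiag_eq_norm_sq (x : D) : kernelDiag H x = ‖kernelSection H x‖ ^ 2 :=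
  kernelDiag_eq x

theorem kernelSection_apply_self (x : D) : kernelSection H x x = kernelDiag H x := by
  rw [← inner_kernelSection x, inner_self_eq_norm_sq_to_K, kernelDiag_eq_norm_sq]
  norm_cast

theorem kernelDiag_nonneg (x : D) : 0 ≤ kernelDiag H x := by
  rw [kernelDiag_eq_norm_sq]
  positivity

/-- The projection moves to the other side of the scalar product: the value at x is ⟨k - Pk, f⟩ with
k = K(·, x). Cauchy–Schwarz and Pythagoras for k finish. -/
theorem norm_sub_sum_apply_sq_le {κ : Type*} {b : κ → H} (hb : Orthonormal ℂ b) (F : Finset κ)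
    (f : H) (x : D) : ‖(f - ∑ i ∈ F, ⟪b i, f⟫_ℂ • b i) x‖ ^ 2 ≤
      ‖f‖ ^ 2 * (kernelDiag H x - ∑ i ∈ F, ‖b i x‖ ^ 2) := by
  set k := kernelSection H x
  have h1 : ⟪k, f - ∑ i ∈ F, ⟪b i, f⟫_ℂ • b i⟫_ℂ = ⟪k - ∑ i ∈ F, ⟪b i, k⟫_ℂ • b i, f⟫_ℂ := by
    simp only [inner_sub_left, inner_sub_right, inner_sum, sum_inner, inner_smul_left,
      inner_smul_right, inner_conj_symm]
    congr 1
    exact Finset.sum_congr rfl fun i _ => mul_comm _ _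
  have h2 := norm_sub_sum_inner_smul_sq hb F k
  rw [← kernelDiag_eq_norm_sq] at h2
  simp only [k, inner_kernelSection', RCLike.norm_conj] at h2
  rw [← inner_kernelSection, h1, ← h2, ← mul_pow, mul_comm ‖f‖]
  gcongr
  simpa only [k, inner_kernelSection'] using
    norm_inner_le_norm (𝕜 := ℂ) (k - ∑ i ∈ F, ⟪b i, k⟫_ℂ • b i) f

theorem hasSum_norm_apply_sq {κ : Type*} (b : HilbertBasis κ ℂ H) (x : D) :
    HasSum (fun i => ‖b i x‖ ^ 2) (kernelDiag H x) := by
  have h := b.hasSum_inner_mul_inner (kernelSection H x) (kernelSection H x)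
  simp only [inner_kernelSection', inner_kernelSection, kernelSection_apply_self,
    Complex.mul_conj', Complex.conj_ofReal] at h
  exact_mod_cast h

variable [MeasurableSpace D]

/-- Separability makes a Hilbert basis countable, and the diagonal is the sum of the |b_i|², each of
which is measurable. -/
theorem measurable_kernelDiag [TopologicalSpace.SeparableSpace H]
    (hmeas : ∀ f : H, Measurable f) : Measurable (kernelDiag H : D → ℝ) := by
  obtain ⟨w, b, -⟩ := exists_hilbertBasis ℂ H
  have := countable_of_orthonormal b.orthonormal
  have h : (kernelDiag H : D → ℝ) =
      fun x => (∑' i, ENNReal.ofReal (‖b i x‖ ^ 2)).toReal := by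
    funext x
    rw [← ENNReal.ofReal_tsum_of_nonneg (fun i => sq_nonneg _) (hasSum_norm_apply_sq b x).summable,
      (hasSum_norm_apply_sq b x).tsum_eq, ENNReal.toReal_ofReal (kernelDiag_nonneg x)]
  rw [h]
  refine Measurable.ennreal_toReal (Measurable.tsum fun i => ?_)
  exact ((hmeas (b i)).norm.pow_const 2).ennreal_ofReal

variable (ρ : Measure D) (hmeas : ∀ f : H, Measurable f) (htr : FiniteTrace H ρ)

theorem enorm_embedding_sq (f : H) :
    ‖embedding ρ hmeas htr f‖ₑ ^ 2 = ∫⁻ x, ENNReal.ofReal (‖f x‖ ^ 2) ∂ρ := by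
  have h : ‖embedding ρ hmeas htr f‖ₑ = eLpNorm f 2 ρ := Lp.enorm_toLp (memLp ρ hmeas htr f)
  rw [h, eLpNorm_eq_lintegral_rpow_enorm_toReal (by norm_num) (by norm_num)]
  simp only [ENNReal.toReal_ofNat]
  rw [← ENNReal.rpow_natCast, ← ENNReal.rpow_mul]
  norm_num only [ENNReal.rpow_one, ENNReal.rpow_ofNat]
  refine lintegral_congr fun x => ?_
  rw [← ofReal_norm, ENNReal.ofReal_pow (norm_nonneg _)]

theorem norm_embedding_sub_sum_sq_le {κ : Type*} [Countable κ] (b : HilbertBasis κ ℂ H)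
    (F : Finset κ) (f : H) :
    ‖embedding ρ hmeas htr (f - ∑ i ∈ F, ⟪b i, f⟫_ℂ • b i)‖ₑ ^ 2 ≤
      ‖f‖ₑ ^ 2 * ∑' i : {i // i ∉ F}, ∫⁻ x, ENNReal.ofReal (‖b i x‖ ^ 2) ∂ρ := by
  rw [enorm_embedding_sq, ← lintegral_tsum fun i : {i // i ∉ F} =>
    ((hmeas (b i)).norm.pow_const 2).ennreal_ofReal.aemeasurable,
    ← lintegral_const_mul' _ _ (by finiteness)]
  refine lintegral_mono fun x => ?_
  have h1 : ENNReal.ofReal (kernelDiag H x - ∑ i ∈ F, ‖b i x‖ ^ 2) =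
      ∑' i : {i // i ∉ F}, ENNReal.ofReal (‖b i x‖ ^ 2) := by
    have h2 : ENNReal.ofReal (kernelDiag H x) = ∑' i, ENNReal.ofReal (‖b i x‖ ^ 2) := by
      rw [← (hasSum_norm_apply_sq b x).tsum_eq, ENNReal.ofReal_tsum_of_nonneg
        (fun i => sq_nonneg _) (hasSum_norm_apply_sq b x).summable]
    have h3 : ∑ i ∈ F, ENNReal.ofReal (‖b i x‖ ^ 2) +
        ∑' i : {i // i ∉ F}, ENNReal.ofReal (‖b i x‖ ^ 2) =
        ∑' i, ENNReal.ofReal (‖b i x‖ ^ 2) :=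
      ENNReal.sum_add_tsum_compl F fun i => ENNReal.ofReal (‖b i x‖ ^ 2)
    rw [ENNReal.ofReal_sub _ (Finset.sum_nonneg fun i _ => sq_nonneg _), h2, ← h3,
      ENNReal.ofReal_sum_of_nonneg fun i _ => sq_nonneg _]
    exact ENNReal.add_sub_cancel_left (ENNReal.sum_ne_top.2 fun i _ => ENNReal.ofReal_ne_top)
  rw [← h1, ← ofReal_norm, ← ENNReal.ofReal_pow (norm_nonneg _),
    ← ENNReal.ofReal_mul (by positivity)]
  exact ENNReal.ofReal_le_ofReal (norm_sub_sum_apply_sq_le b.orthonormal F f x)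

/-- The embedding is Hilbert–Schmidt: cutting a basis at a finite set `F` gives a finite-rank
operator whose squared distance is at most the tail of the convergent sum ∑ ∫|b_i|² = ∫ K(x,x). -/
theorem isCompactOperator_embedding [TopologicalSpace.SeparableSpace H] :
    IsCompactOperator (embedding ρ hmeas htr) := by
  obtain ⟨w, b, -⟩ := exists_hilbertBasis ℂ H
  have := countable_of_orthonormal b.orthonormal
  let a : w → ℝ≥0∞ := fun i => ∫⁻ x, ENNReal.ofReal (‖b i x‖ ^ 2) ∂ρ
  have ha : ∑' i, a i ≠ ∞ := by
    have : ∑' i, a i = ∫⁻ x, ENNReal.ofReal (kernelDiag H x) ∂ρ := by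
      rw [← lintegral_tsum fun i => ((hmeas (b i)).norm.pow_const 2).ennreal_ofReal.aemeasurable]
      refine lintegral_congr fun x => ?_
      rw [← (hasSum_norm_apply_sq b x).tsum_eq, ENNReal.ofReal_tsum_of_nonneg
        (fun i => sq_nonneg _) (hasSum_norm_apply_sq b x).summable]
    rw [this]
    exact htr.ne
  let r : Finset w → ℝ := fun F => Real.sqrt (∑' i : {i // i ∉ F}, a i).toReal
  have hr : Filter.Tendsto r Filter.atTop (nhds 0) := by
    have h1 := (ENNReal.tendsto_toReal ENNReal.zero_ne_top).comp
      (ENNReal.tendsto_tsum_compl_atTop_zero ha)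
    have h2 := (Real.continuous_sqrt.tendsto _).comp h1
    simp only [ENNReal.toReal_zero, Real.sqrt_zero] at h2
    exact h2
  let G : Finset w → H →L[ℂ] Lp ℂ 2 ρ := fun F =>
    ∑ i ∈ F, (innerSL ℂ (b i)).smulRight (embedding ρ hmeas htr (b i))
  have hG : ∀ F f, embedding ρ hmeas htr f - G F f =
      embedding ρ hmeas htr (f - ∑ i ∈ F, ⟪b i, f⟫_ℂ • b i) := fun F f => by
    simp [G]
  have hGc : ∀ F, IsCompactOperator (G F) := fun F => by
    have h1 : ∀ i, IsCompactOperator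
        ((innerSL ℂ (b i)).smulRight (embedding ρ hmeas htr (b i))) := fun i =>
      (isCompactOperator_of_locallyCompactSpace_dom (innerSL ℂ (b i))).clm_comp
        (ContinuousLinearMap.toSpanSingleton ℂ (embedding ρ hmeas htr (b i)))
    have h2 : ∀ F : Finset w, (∑ i ∈ F, (innerSL ℂ (b i)).smulRight
        (embedding ρ hmeas htr (b i))) ∈ compactOperator (RingHom.id ℂ) H (Lp ℂ 2 ρ) :=
      fun F => Submodule.sum_mem _ fun i _ => h1 i
    exact h2 F
  refine isCompactOperator_of_tendsto (l := Filter.atTop) (F := G) ?_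
    (Filter.Eventually.of_forall hGc)
  rw [tendsto_iff_norm_sub_tendsto_zero]
  refine squeeze_zero (fun F => norm_nonneg _) (fun F => ?_) hr
  rw [norm_sub_rev]
  refine ContinuousLinearMap.opNorm_le_bound _ (Real.sqrt_nonneg _) fun f => ?_
  rw [sub_apply, hG]
  have h1 := norm_embedding_sub_sum_sq_le ρ hmeas htr b F f
  have hfin : ∑' i : {i // i ∉ F}, a i ≠ ∞ := ne_top_of_le_ne_top ha
    (ENNReal.tsum_comp_le_tsum_of_injective Subtype.val_injective a)
  have h2 := ENNReal.toReal_mono (ENNReal.mul_ne_top (by finiteness) hfin) h1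
  rw [ENNReal.toReal_mul, ENNReal.toReal_pow, ENNReal.toReal_pow, toReal_enorm, toReal_enorm] at h2
  refine le_of_sq_le_sq ?_ (by positivity)
  rw [mul_pow, Real.sq_sqrt ENNReal.toReal_nonneg, mul_comm]
  exact h2

theorem inner_covOp (f g : H) : ⟪f, covOp ρ hmeas htr g⟫_ℂ =
    ⟪embedding ρ hmeas htr f, embedding ρ hmeas htr g⟫_ℂ := by
  rw [covOp, ContinuousLinearMap.comp_apply, ContinuousLinearMap.adjoint_inner_right]

theorem inner_covOp_left (f g : H) : ⟪covOp ρ hmeas htr f, g⟫_ℂ =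
    ⟪embedding ρ hmeas htr f, embedding ρ hmeas htr g⟫_ℂ := by
  rw [covOp, ContinuousLinearMap.comp_apply, ContinuousLinearMap.adjoint_inner_left]

theorem isSymmetric_covOp : (covOp ρ hmeas htr : H →ₗ[ℂ] H).IsSymmetric := fun f g => by
  simp only [ContinuousLinearMap.coe_coe]
  rw [inner_covOp, inner_covOp_left]

theorem isCompactOperator_covOp [TopologicalSpace.SeparableSpace H] :
    IsCompactOperator (covOp ρ hmeas htr) :=
  (isCompactOperator_embedding ρ hmeas htr).clm_comp (embedding ρ hmeas htr).adjoint

end Embedding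


/-! ### Eigenvector expansions and regular points -/

section EigenSystem

variable {D : Type*} {H : Type*}
  [NormedAddCommGroup H]

/-- The eigenvectors, replaced by zero at the indices of the eigenvalues zero. -/
def eig (lam : ℕ → ℝ) (e : ℕ → H) (j : ℕ) : H := if 0 < lam j then e j else 0

theorem eig_of_pos {lam : ℕ → ℝ} {e : ℕ → H} {j : ℕ} (hj : 0 < lam j) : eig lam e j = e j := by
  simp [eig, hj]

variable [InnerProductSpace ℂ H] {W : H →L[ℂ] H} {lam : ℕ → ℝ} {e : ℕ → H}

theorem IsEigenSystem.inner_eig (he : IsEigenSystem W lam e) (i j : ℕ) :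
    ⟪eig lam e i, eig lam e j⟫_ℂ = if i = j ∧ 0 < lam i then 1 else 0 := by
  by_cases hi : 0 < lam i
  · by_cases hj : 0 < lam j
    · have := (orthonormal_iff_ite.1 he.orthonormal) ⟨i, hi⟩ ⟨j, hj⟩
      simp only [Subtype.mk.injEq] at this
      simp only [eig, hi, hj, if_true, and_true]
      exact this
    · have : i ≠ j := by rintro rfl; exact hj hi
      simp [eig, hj, this]
  · simp [eig, hi]

theorem IsEigenSystem.apply_eig (he : IsEigenSystem W lam e) (j : ℕ) :
    W (eig lam e j) = (lam j : ℂ) • eig lam e j := by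
  by_cases hj : 0 < lam j
  · simp [eig, hj, he.apply_eq j hj]
  · simp [eig, hj]

theorem IsEigenSystem.orthonormal_eig (he : IsEigenSystem W lam e) :
    Orthonormal ℂ fun j : {j : ℕ // 0 < lam j} => eig lam e j := by
  convert he.orthonormal using 2 with j
  exact eig_of_pos j.2

theorem IsEigenSystem.sum_norm_inner_sq_le (he : IsEigenSystem W lam e) (f : H) (F : Finset ℕ) :
    ∑ j ∈ F, ‖⟪eig lam e j, f⟫_ℂ‖ ^ 2 ≤ ‖f‖ ^ 2 := by
  classical
  have h := he.orthonormal_eig.sum_inner_products_le f (s := F.subtype fun j => 0 < lam j)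
  refine le_trans (le_of_eq ?_) h
  rw [Finset.sum_subtype_eq_sum_filter (f := fun j => ‖⟪eig lam e j, f⟫_ℂ‖ ^ 2),
    Finset.sum_filter]
  refine Finset.sum_congr rfl fun j _ => ?_
  by_cases hj : 0 < lam j
  · simp [hj]
  · simp [eig, hj]

variable [CompleteSpace H]

theorem IsEigenSystem.exists_hasSum (he : IsEigenSystem W lam e) (f : H) :
    ∃ g : H, HasSum (fun j => ⟪eig lam e j, f⟫_ℂ • eig lam e j) g ∧
      ∀ j, ⟪eig lam e j, f - g⟫_ℂ = 0 := by
  have hs : Summable fun j : {j : ℕ // 0 < lam j} => ⟪eig lam e j, f⟫_ℂ • eig lam e j := by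
    have h1 := he.orthonormal_eig.orthogonalFamily.summable_iff_norm_sq_summable
      (fun j => ⟪eig lam e j, f⟫_ℂ)
    simp only [LinearIsometry.toSpanSingleton_apply] at h1
    exact h1.2 (he.orthonormal_eig.inner_products_summable f)
  obtain ⟨g, hg⟩ := hs
  have hg' : HasSum (fun j => ⟪eig lam e j, f⟫_ℂ • eig lam e j) g := by
    refine (Function.Injective.hasSum_iff Subtype.val_injective fun j hj => ?_).1 hg
    have : ¬ 0 < lam j := fun h => hj ⟨⟨j, h⟩, rfl⟩
    simp [eig, this]
  refine ⟨g, hg', fun j => ?_⟩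
  have h2 := hg'.mapL (innerSL ℂ (eig lam e j))
  have h3 : HasSum (fun i => (innerSL ℂ (eig lam e j)) (⟪eig lam e i, f⟫_ℂ • eig lam e i))
      ⟪eig lam e j, f⟫_ℂ := by
    convert hasSum_single j fun i hi => ?_ using 1
    · rw [innerSL_apply_apply, inner_smul_right, he.inner_eig]
      by_cases hj : 0 < lam j
      · simp [hj]
      · simp [eig, hj]
    · rw [innerSL_apply_apply, inner_smul_right, he.inner_eig]
      simp [hi.symm]
  have h4 := h2.unique h3
  rw [innerSL_apply_apply] at h4
  rw [inner_sub_right, h4, sub_self]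

/-- On the orthogonal complement of the eigenvectors W restricts to a compact symmetric operator. A
nonzero eigenvalue there would be positive, against `he.complete`; without nonzero eigenvalues the
restriction is zero. -/
theorem IsEigenSystem.apply_eq_zero (he : IsEigenSystem W lam e) (hW : IsCompactOperator W)
    (hs : (W : H →ₗ[ℂ] H).IsSymmetric) (hpos : ∀ f, 0 ≤ RCLike.re ⟪f, W f⟫_ℂ) {v : H}
    (hv : ∀ j, ⟪eig lam e j, v⟫_ℂ = 0) : W v = 0 := by
  set V : Submodule ℂ H := (Submodule.span ℂ (Set.range (eig lam e)))ᗮ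
  have hmem : ∀ u : H, u ∈ V ↔ ∀ j, ⟪eig lam e j, u⟫_ℂ = 0 := fun u => by
    rw [Submodule.mem_orthogonal]
    refine ⟨fun h j => h _ (Submodule.subset_span ⟨j, rfl⟩), fun h w hw => ?_⟩
    induction hw using Submodule.span_induction with
    | mem w hw => obtain ⟨j, rfl⟩ := hw; exact h j
    | zero => exact inner_zero_left _
    | add a b _ _ ha hb => rw [inner_add_left, ha, hb, add_zero]
    | smul c a _ ha => rw [inner_smul_left, ha, mul_zero]
  have hinv : ∀ u ∈ V, (W : H →ₗ[ℂ] H) u ∈ V := fun u hu => by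
    rw [hmem] at hu ⊢
    intro j
    have h1 := hs (eig lam e j) u
    simp only [ContinuousLinearMap.coe_coe] at h1 ⊢
    rw [← h1, he.apply_eig, inner_smul_left, hu j, mul_zero]
  let S : V →L[ℂ] V := W.restrict hinv
  have hSc : IsCompactOperator S := hW.restrict' hinv
  have hSs : (S : V →ₗ[ℂ] V).IsSymmetric := hs.restrict_invariant hinv
  have hS0 : S = 0 := by
    refine (ContinuousLinearMap.eq_zero_of_forall_hasEigenvalue_eq_zero hSc hSs).1 fun μ hμ => ?_
    have hreal : (starRingEnd ℂ) μ = μ := hSs.conj_eigenvalue_eq_self hμ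
    obtain ⟨u, hu⟩ := hμ.exists_hasEigenvector
    have hSu : S u = μ • u := hu.apply_eq_smul
    have hWu : W (u : H) = μ • (u : H) := congrArg Subtype.val hSu
    have hu0 : (u : H) ≠ 0 := fun h => hu.2 (Subtype.ext h)
    obtain ⟨r, rfl⟩ := Complex.conj_eq_iff_real.1 hreal
    have hr : 0 ≤ r := by
      have h1 := hpos u
      rw [hWu, inner_smul_right, inner_self_eq_norm_sq_to_K] at h1
      have h2 : 0 ≤ r * ‖(u : H)‖ ^ 2 := by
        convert h1 using 1
        simp [← Complex.ofReal_pow]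
      exact nonneg_of_mul_nonneg_left h2 (by positivity)
    by_contra hne
    have hr' : 0 < r := lt_of_le_of_ne hr fun h => hne (by rw [← h, Complex.ofReal_zero])
    refine hu0 (he.complete r u hr' hWu fun j hj => ?_)
    rw [← eig_of_pos (e := e) hj]
    exact (hmem _).1 u.2 j
  have h := congrArg Subtype.val (DFunLike.congr_fun hS0 (⟨v, (hmem v).2 hv⟩ : V))
  exact h

variable [RKHS ℂ H D ℂ]

/-- The points at which all the functions orthogonal to the eigenvectors vanish. -/
def IsRegular (lam : ℕ → ℝ) (e : ℕ → H) (x : D) : Prop :=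
  ∀ v : H, (∀ j, ⟪eig lam e j, v⟫_ℂ = 0) → v x = 0

theorem IsRegular.hasSum_apply (he : IsEigenSystem W lam e) {x : D} (hx : IsRegular lam e x)
    (f : H) : HasSum (fun j => ⟪eig lam e j, f⟫_ℂ * eig lam e j x) (f x) := by
  obtain ⟨g, hg, hfg⟩ := he.exists_hasSum f
  have h1 := hx _ hfg
  rw [RKHS.coe_sub, Pi.sub_apply, sub_eq_zero] at h1
  rw [h1]
  have h2 := hg.mapL (innerSL ℂ (kernelSection H x))
  simpa only [innerSL_apply_apply, inner_smul_right, inner_kernelSection] using h2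

theorem IsRegular.hasSum_norm_sq (he : IsEigenSystem W lam e) {x : D} (hx : IsRegular lam e x) :
    HasSum (fun j => ‖eig lam e j x‖ ^ 2) (kernelDiag H x) := by
  have h := hx.hasSum_apply he (kernelSection H x)
  simp only [inner_kernelSection', Complex.conj_mul', kernelSection_apply_self] at h
  exact_mod_cast h

theorem IsEigenSystem.sum_norm_apply_sq_le (he : IsEigenSystem W lam e) (x : D) (F : Finset ℕ) :
    ∑ j ∈ F, ‖eig lam e j x‖ ^ 2 ≤ kernelDiag H x := by
  have h := he.sum_norm_inner_sq_le (kernelSection H x) F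
  rw [← kernelDiag_eq_norm_sq] at h
  simpa only [inner_kernelSection', RCLike.norm_conj] using h

/-- The remainder of the eigenvector expansion after `N` terms. -/
def remainder (lam : ℕ → ℝ) (e : ℕ → H) (N : ℕ) (f : H) : H :=
  f - ∑ j ∈ Finset.range N, ⟪eig lam e j, f⟫_ℂ • eig lam e j

theorem IsRegular.hasSum_remainder (he : IsEigenSystem W lam e) {x : D} (hx : IsRegular lam e x)
    (N : ℕ) (f : H) :
    HasSum (fun j => ⟪eig lam e (j + N), f⟫_ℂ * eig lam e (j + N) x) (remainder lam e N f x) := by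
  have h := (hasSum_nat_add_iff' N).2 (hx.hasSum_apply he f)
  have h2 : remainder lam e N f x =
      f x - ∑ j ∈ Finset.range N, ⟪eig lam e j, f⟫_ℂ * eig lam e j x := by
    simp only [remainder, ← inner_kernelSection x, inner_sub_right, inner_sum, inner_smul_right]
  rw [h2]
  exact h

variable [MeasurableSpace D] {ρ : Measure D} {hmeas : ∀ f : H, Measurable f}
  {htr : FiniteTrace H ρ}

theorem norm_embedding_sq (f : H) : ‖embedding ρ hmeas htr f‖ ^ 2 =
    RCLike.re ⟪f, covOp ρ hmeas htr f⟫_ℂ := by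
  rw [inner_covOp, inner_self_eq_norm_sq_to_K]
  norm_cast

theorem IsEigenSystem.embedding_eq_zero [TopologicalSpace.SeparableSpace H]
    (he : IsEigenSystem (covOp ρ hmeas htr) lam e) {v : H} (hv : ∀ j, ⟪eig lam e j, v⟫_ℂ = 0) :
    embedding ρ hmeas htr v = 0 := by
  have h := he.apply_eq_zero (isCompactOperator_covOp ρ hmeas htr) (isSymmetric_covOp ρ hmeas htr)
    (fun f => by rw [← norm_embedding_sq]; positivity) hv
  have h2 := norm_embedding_sq (ρ := ρ) (hmeas := hmeas) (htr := htr) v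
  rw [h, inner_zero_right, map_zero] at h2
  exact norm_eq_zero.1 (pow_eq_zero_iff two_ne_zero |>.1 h2)

/-- Each single v orthogonal to the eigenvectors vanishes off a null set depending on v. A countable
dense set of such v yields one common null set, and continuity of point evaluation extends it to all
v. -/
theorem IsEigenSystem.ae_isRegular [TopologicalSpace.SeparableSpace H]
    (he : IsEigenSystem (covOp ρ hmeas htr) lam e) : ∀ᵐ x ∂ρ, IsRegular lam e x := by
  let V : Set H := {v | ∀ j, ⟪eig lam e j, v⟫_ℂ = 0}
  have hsep : TopologicalSpace.IsSeparable V := .of_separableSpace V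
  obtain ⟨c, hcV, hc, hVc⟩ := hsep.exists_countable_dense_subset
  have h1 : ∀ᵐ x ∂ρ, ∀ v ∈ c, v x = 0 := by
    rw [ae_ball_iff hc]
    intro v hv
    have h2 := coeFn_embedding ρ hmeas htr v
    rw [he.embedding_eq_zero (hcV hv)] at h2
    filter_upwards [h2, Lp.coeFn_zero ℂ 2 ρ] with x hx hx0
    rw [← hx, hx0, Pi.zero_apply]
  filter_upwards [h1] with x hx v hv
  have hcl : IsClosed {f : H | f x = 0} :=
    isClosed_eq (RKHS.continuous_eval x) continuous_const
  exact closure_minimal (fun v hv => hx v hv) hcl (hVc hv)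

theorem IsEigenSystem.norm_embedding_eig_sq (he : IsEigenSystem (covOp ρ hmeas htr) lam e)
    (j : ℕ) : ‖embedding ρ hmeas htr (eig lam e j)‖ ^ 2 = lam j := by
  rw [norm_embedding_sq, he.apply_eig, inner_smul_right, he.inner_eig]
  by_cases hj : 0 < lam j
  · simp [hj]
  · simp [le_antisymm (not_lt.1 hj) (he.nonneg j)]

theorem IsEigenSystem.lintegral_eig_sq (he : IsEigenSystem (covOp ρ hmeas htr) lam e) (j : ℕ) :
    ∫⁻ x, ENNReal.ofReal (‖eig lam e j x‖ ^ 2) ∂ρ = ENNReal.ofReal (lam j) := by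
  rw [← enorm_embedding_sq ρ hmeas htr, ← he.norm_embedding_eig_sq j,
    ENNReal.ofReal_pow (norm_nonneg _), ofReal_norm]

/-- At regular points the integrand is the tail of ∑ |e_j(x)|², which is integrated term by term. -/
theorem IsEigenSystem.lintegral_kernelDiag_sub [TopologicalSpace.SeparableSpace H]
    (he : IsEigenSystem (covOp ρ hmeas htr) lam e) (N : ℕ) :
    ∫⁻ x, ENNReal.ofReal (kernelDiag H x - ∑ j ∈ Finset.range N, ‖eig lam e j x‖ ^ 2) ∂ρ =
      ∑' j, ENNReal.ofReal (lam (j + N)) := by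
  have h1 : ∀ᵐ x ∂ρ,
      ENNReal.ofReal (kernelDiag H x - ∑ j ∈ Finset.range N, ‖eig lam e j x‖ ^ 2) =
      ∑' j, ENNReal.ofReal (‖eig lam e (j + N) x‖ ^ 2) := by
    filter_upwards [he.ae_isRegular] with x hx
    have h2 := hx.hasSum_norm_sq he
    have h3 := (hasSum_nat_add_iff' N).2 h2
    rw [← h3.tsum_eq, ENNReal.ofReal_tsum_of_nonneg (fun j => sq_nonneg _) h3.summable]
  rw [lintegral_congr_ae h1, lintegral_tsum fun j =>
    ((hmeas (eig lam e (j + N))).norm.pow_const 2).ennreal_ofReal.aemeasurable]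
  exact tsum_congr fun j => he.lintegral_eig_sq (j + N)

theorem IsEigenSystem.summable [TopologicalSpace.SeparableSpace H]
    (he : IsEigenSystem (covOp ρ hmeas htr) lam e) : Summable lam := by
  have h := he.lintegral_kernelDiag_sub 0
  simp only [Finset.range_zero, Finset.sum_empty, sub_zero, add_zero] at h
  have h2 : ∑' j, ENNReal.ofReal (lam j) ≠ ∞ := by
    rw [← h]
    exact htr.ne
  have h3 := ENNReal.summable_toReal h2
  simpa only [ENNReal.toReal_ofReal (he.nonneg _)] using h3

theorem IsEigenSystem.inner_embedding_eig_eq_zero (he : IsEigenSystem (covOp ρ hmeas htr) lam e)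
    {j : ℕ} {f : H} (hf : ⟪f, eig lam e j⟫_ℂ = 0) :
    ⟪embedding ρ hmeas htr f, embedding ρ hmeas htr (eig lam e j)⟫_ℂ = 0 := by
  rw [← inner_covOp, he.apply_eig, inner_smul_right, hf, mul_zero]

theorem IsEigenSystem.norm_embedding_sum_sq (he : IsEigenSystem (covOp ρ hmeas htr) lam e)
    (F : Finset ℕ) (c : ℕ → ℂ) : ‖embedding ρ hmeas htr (∑ j ∈ F, c j • eig lam e j)‖ ^ 2 =
      ∑ j ∈ F, ‖c j‖ ^ 2 * lam j := by
  have h : ⟪∑ j ∈ F, c j • eig lam e j, covOp ρ hmeas htr (∑ j ∈ F, c j • eig lam e j)⟫_ℂ =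
      ((∑ j ∈ F, ‖c j‖ ^ 2 * lam j : ℝ) : ℂ) := by
    simp only [map_sum, map_smul, he.apply_eig, sum_inner, inner_sum, inner_smul_left,
      inner_smul_right, he.inner_eig]
    push_cast
    refine Finset.sum_congr rfl fun j hj => ?_
    rw [Finset.sum_eq_single_of_mem j hj fun i _ hij => by simp [hij], ← Complex.conj_mul']
    by_cases h : 0 < lam j
    · simp [h]; ring
    · simp [le_antisymm (not_lt.1 h) (he.nonneg j)]
  rw [norm_embedding_sq, h]
  exact Complex.ofReal_re _

/-- The images of the eigenvectors are orthogonal with squared norms λ_j ≤ `lam N` for j ≥ N.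
Bessel's inequality bounds finite pieces, and the part of f orthogonal to all eigenvectors has image
zero. -/
theorem IsEigenSystem.norm_embedding_remainder_sq_le [TopologicalSpace.SeparableSpace H]
    (he : IsEigenSystem (covOp ρ hmeas htr) lam e) (N : ℕ) (f : H) :
    ‖embedding ρ hmeas htr (remainder lam e N f)‖ ^ 2 ≤ lam N * ‖f‖ ^ 2 := by
  obtain ⟨g, hg, hfg⟩ := he.exists_hasSum f
  have hE : embedding ρ hmeas htr f = embedding ρ hmeas htr g := by
    have := he.embedding_eq_zero hfg
    rwa [map_sub, sub_eq_zero] at this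
  have h1 : Filter.Tendsto (fun J => embedding ρ hmeas htr
      (∑ j ∈ Finset.range J, ⟪eig lam e j, f⟫_ℂ • eig lam e j -
        ∑ j ∈ Finset.range N, ⟪eig lam e j, f⟫_ℂ • eig lam e j)) Filter.atTop
      (nhds (embedding ρ hmeas htr (remainder lam e N f))) := by
    rw [remainder, map_sub, hE, ← map_sub]
    exact ((embedding ρ hmeas htr).continuous.tendsto _).comp
      (hg.tendsto_sum_nat.sub tendsto_const_nhds)
  refine le_of_tendsto (h1.norm.pow 2) ?_
  filter_upwards [Filter.eventually_ge_atTop N] with J hJ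
  rw [← Finset.sum_sdiff_eq_sub (Finset.range_mono hJ), he.norm_embedding_sum_sq]
  calc ∑ j ∈ Finset.range J \ Finset.range N, ‖⟪eig lam e j, f⟫_ℂ‖ ^ 2 * lam j
      ≤ ∑ j ∈ Finset.range J \ Finset.range N, ‖⟪eig lam e j, f⟫_ℂ‖ ^ 2 * lam N := by
        refine Finset.sum_le_sum fun j hj => mul_le_mul_of_nonneg_left (he.antitone ?_)
          (sq_nonneg _)
        simpa using (Finset.mem_sdiff.1 hj).2
    _ = lam N * ∑ j ∈ Finset.range J \ Finset.range N, ‖⟪eig lam e j, f⟫_ℂ‖ ^ 2 := by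
        rw [← Finset.sum_mul, mul_comm]
    _ ≤ lam N * ‖f‖ ^ 2 := by
        gcongr
        · exact he.nonneg N
        · exact he.sum_norm_inner_sq_le f _

end EigenSystem


/-! ### The sampling density -/

section Density

variable {D : Type*} {H : Type*} [NormedAddCommGroup H] [InnerProductSpace ℂ H]
  {W : H →L[ℂ] H} {lam : ℕ → ℝ} {e : ℕ → H} {m : ℕ}

theorem eta_eq_smul_eig {j : ℕ} (hj : 0 < lam j) :
    eta lam e j = ((sing lam j : ℂ)⁻¹) • eig lam e j := by
  rw [eta, eig_of_pos hj]

theorem IsEigenSystem.pos_of_lt (he : IsEigenSystem W lam e) (hpos : 0 < lam (m - 1)) {j : ℕ}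
    (hj : j < m - 1) : 0 < lam j :=
  hpos.trans_le (he.antitone hj.le)

theorem IsEigenSystem.tsum_pos (he : IsEigenSystem W lam e) (hsum : Summable lam)
    (hpos : 0 < lam (m - 1)) : 0 < ∑' j, lam (j + (m - 1)) :=
  ((summable_nat_add_iff (m - 1)).2 hsum).tsum_pos (fun j => he.nonneg _) 0 (by simpa using hpos)

variable [RKHS ℂ H D ℂ]

theorem norm_eta_apply_sq {j : ℕ} (hj : 0 < lam j) (x : D) :
    ‖eta lam e j x‖ ^ 2 = (lam j)⁻¹ * ‖eig lam e j x‖ ^ 2 := by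
  rw [eta_eq_smul_eig hj, RKHS.coe_smul, Pi.smul_apply, norm_smul, mul_pow, norm_inv, inv_pow,
    Complex.norm_real, Real.norm_eq_abs, sq_abs, sing, Real.sq_sqrt hj.le]

theorem IsEigenSystem.sum_norm_sq_eq (he : IsEigenSystem W lam e) (hpos : 0 < lam (m - 1))
    (x : D) : ∑ j ∈ Finset.range (m - 1), ‖e j x‖ ^ 2 =
      ∑ j ∈ Finset.range (m - 1), ‖eig lam e j x‖ ^ 2 :=
  Finset.sum_congr rfl fun j hj => by
    rw [eig_of_pos (he.pos_of_lt hpos (Finset.mem_range.1 hj))]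

variable [CompleteSpace H]

theorem IsEigenSystem.residual_nonneg (he : IsEigenSystem W lam e) (hpos : 0 < lam (m - 1))
    (x : D) : 0 ≤ kernelDiag H x - ∑ j ∈ Finset.range (m - 1), ‖e j x‖ ^ 2 := by
  rw [he.sum_norm_sq_eq hpos, sub_nonneg]
  exact he.sum_norm_apply_sq_le x _

/-- Dropping the nonnegative second half of the density leaves this bound; dropping the first half
gives `IsEigenSystem.residual_le`. They supply the constants M = 2(m-1) and M = 2T of the tail
bounds. -/
theorem IsEigenSystem.sum_norm_eta_sq_le (he : IsEigenSystem W lam e) (hsum : Summable lam)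
    (hm : 2 ≤ m) (hpos : 0 < lam (m - 1)) (x : D) :
    ∑ j ∈ Finset.range (m - 1), ‖eta lam e j x‖ ^ 2 ≤
      2 * ((m : ℝ) - 1) * density lam e m x := by
  have h1 := he.residual_nonneg hpos x
  have h2 := he.tsum_pos hsum hpos
  have h3 : (0 : ℝ) < (m : ℝ) - 1 := by
    have : (2 : ℝ) ≤ m := by exact_mod_cast hm
    linarith
  have h4 : 2 * ((m : ℝ) - 1) * density lam e m x =
      ∑ j ∈ Finset.range (m - 1), ‖eta lam e j x‖ ^ 2 + ((m : ℝ) - 1) *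
        ((∑' j, lam (j + (m - 1)))⁻¹ *
          (kernelDiag H x - ∑ j ∈ Finset.range (m - 1), ‖e j x‖ ^ 2)) := by
    rw [density]
    field_simp
  rw [h4]
  have : 0 ≤ ((m : ℝ) - 1) * ((∑' j, lam (j + (m - 1)))⁻¹ *
      (kernelDiag H x - ∑ j ∈ Finset.range (m - 1), ‖e j x‖ ^ 2)) := by positivity
  linarith

theorem IsEigenSystem.residual_le (he : IsEigenSystem W lam e) (hsum : Summable lam)
    (hm : 2 ≤ m) (hpos : 0 < lam (m - 1)) (x : D) :
    kernelDiag H x - ∑ j ∈ Finset.range (m - 1), ‖eig lam e j x‖ ^ 2 ≤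
      2 * (∑' j, lam (j + (m - 1))) * density lam e m x := by
  have h2 := he.tsum_pos hsum hpos
  have h3 : (0 : ℝ) < (m : ℝ) - 1 := by
    have : (2 : ℝ) ≤ m := by exact_mod_cast hm
    linarith
  set T := ∑' j, lam (j + (m - 1))
  have h4 : 2 * T * density lam e m x =
      T * (((m : ℝ) - 1)⁻¹ * ∑ j ∈ Finset.range (m - 1), ‖eta lam e j x‖ ^ 2) +
        (kernelDiag H x - ∑ j ∈ Finset.range (m - 1), ‖e j x‖ ^ 2) := by
    rw [density]
    change 2 * T * (1 / 2 * (_ + T⁻¹ * _)) = _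
    field_simp
  rw [h4, ← he.sum_norm_sq_eq hpos]
  have : 0 ≤ T * (((m : ℝ) - 1)⁻¹ * ∑ j ∈ Finset.range (m - 1), ‖eta lam e j x‖ ^ 2) := by
    positivity
  linarith

theorem IsEigenSystem.density_nonneg (he : IsEigenSystem W lam e) (hsum : Summable lam)
    (hm : 2 ≤ m) (hpos : 0 < lam (m - 1)) (x : D) : 0 ≤ density lam e m x := by
  have h3 : (0 : ℝ) < (m : ℝ) - 1 := by
    have : (2 : ℝ) ≤ m := by exact_mod_cast hm
    linarith
  refine nonneg_of_mul_nonneg_right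
    ((Finset.sum_nonneg fun j _ => sq_nonneg _).trans (he.sum_norm_eta_sq_le hsum hm hpos x))
    (by positivity)

theorem IsEigenSystem.sum_norm_eig_tail_sq_le (he : IsEigenSystem W lam e) (hsum : Summable lam)
    (hm : 2 ≤ m) (hpos : 0 < lam (m - 1)) (J : ℕ) (x : D) :
    ∑ j ∈ Finset.range J, ‖eig lam e (j + (m - 1)) x‖ ^ 2 ≤
      2 * (∑' j, lam (j + (m - 1))) * density lam e m x := by
  refine le_trans ?_ (he.residual_le hsum hm hpos x)
  have h := he.sum_norm_apply_sq_le x (Finset.range (m - 1 + J))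
  rw [Finset.sum_range_add] at h
  simp only [add_comm (m - 1)] at h
  linarith

variable [MeasurableSpace D] [TopologicalSpace.SeparableSpace H]

theorem measurable_density (hmeas : ∀ f : H, Measurable f) : Measurable (density lam e m : D → ℝ) := by
  unfold density
  have h1 : ∀ f : H, Measurable fun x : D => ‖f x‖ ^ 2 := fun f => (hmeas f).norm.pow_const 2
  exact (((Finset.measurable_fun_sum _ fun j _ => h1 _).const_mul _).add
    (((measurable_kernelDiag hmeas).sub
      (Finset.measurable_fun_sum _ fun j _ => h1 _)).const_mul _)).const_mul _

variable {ρ : Measure D} {hmeas : ∀ f : H, Measurable f} {htr : FiniteTrace H ρ}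

theorem IsEigenSystem.isProbabilityMeasure_samplingMeasure
    (he : IsEigenSystem (covOp ρ hmeas htr) lam e) (hm : 2 ≤ m) (hpos : 0 < lam (m - 1)) :
    IsProbabilityMeasure (samplingMeasure ρ lam e m) := by
  have hsum := he.summable
  have hT := he.tsum_pos hsum hpos
  have h3 : (0 : ℝ) < (m : ℝ) - 1 := by
    have : (2 : ℝ) ≤ m := by exact_mod_cast hm
    linarith
  have h1 : ∀ f : H, Measurable fun x : D => ENNReal.ofReal (‖f x‖ ^ 2) := fun f =>
    ((hmeas f).norm.pow_const 2).ennreal_ofReal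
  have hA : ∫⁻ x, ENNReal.ofReal (∑ j ∈ Finset.range (m - 1), ‖eta lam e j x‖ ^ 2) ∂ρ =
      ENNReal.ofReal ((m : ℝ) - 1) := by
    simp only [ENNReal.ofReal_sum_of_nonneg fun _ _ => sq_nonneg _]
    rw [lintegral_finsetSum _ fun j _ => h1 _]
    have : ∀ j ∈ Finset.range (m - 1), ∫⁻ x, ENNReal.ofReal (‖eta lam e j x‖ ^ 2) ∂ρ = 1 :=
      fun j hj => by
        have hj' := he.pos_of_lt hpos (Finset.mem_range.1 hj)
        simp only [norm_eta_apply_sq hj', ENNReal.ofReal_mul (inv_nonneg.2 hj'.le)]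
        rw [lintegral_const_mul _ (h1 _), he.lintegral_eig_sq,
          ← ENNReal.ofReal_mul (inv_nonneg.2 hj'.le), inv_mul_cancel₀ hj'.ne', ENNReal.ofReal_one]
    rw [Finset.sum_congr rfl this]
    simp only [Finset.sum_const, Finset.card_range, nsmul_eq_mul, mul_one]
    rw [← ENNReal.ofReal_natCast, Nat.cast_sub (by omega), Nat.cast_one]
  have hB : ∫⁻ x, ENNReal.ofReal (kernelDiag H x - ∑ j ∈ Finset.range (m - 1), ‖e j x‖ ^ 2) ∂ρ =
      ENNReal.ofReal (∑' j, lam (j + (m - 1))) := by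
    simp only [he.sum_norm_sq_eq hpos]
    rw [he.lintegral_kernelDiag_sub, ENNReal.ofReal_tsum_of_nonneg (fun j => he.nonneg _)
      ((summable_nat_add_iff (m - 1)).2 hsum)]
  refine ⟨?_⟩
  rw [samplingMeasure, withDensity_apply _ MeasurableSet.univ, setLIntegral_univ]
  have h5 : ∀ x : D, ENNReal.ofReal (density lam e m x) =
      ENNReal.ofReal (1 / 2 * ((m : ℝ) - 1)⁻¹) *
        ENNReal.ofReal (∑ j ∈ Finset.range (m - 1), ‖eta lam e j x‖ ^ 2) +
      ENNReal.ofReal (1 / 2 * (∑' j, lam (j + (m - 1)))⁻¹) *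
        ENNReal.ofReal (kernelDiag H x - ∑ j ∈ Finset.range (m - 1), ‖e j x‖ ^ 2) := fun x => by
    have hr := he.residual_nonneg hpos x
    rw [← ENNReal.ofReal_mul (by positivity), ← ENNReal.ofReal_mul (by positivity),
      ← ENNReal.ofReal_add (by positivity) (by positivity), density]
    congr 1
    ring
  simp only [h5]
  have h6 : Measurable fun x : D =>
      ENNReal.ofReal (∑ j ∈ Finset.range (m - 1), ‖eta lam e j x‖ ^ 2) :=
    (Finset.measurable_fun_sum _ fun j _ => (hmeas _).norm.pow_const 2).ennreal_ofReal
  rw [lintegral_add_left (h6.const_mul _), lintegral_const_mul _ h6,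
    lintegral_const_mul' _ _ ENNReal.ofReal_ne_top, hA, hB, ← ENNReal.ofReal_mul (by positivity),
    ← ENNReal.ofReal_mul (by positivity), ← ENNReal.ofReal_add (by positivity) (by positivity)]
  rw [show 1 / 2 * ((m : ℝ) - 1)⁻¹ * ((m : ℝ) - 1) + 1 / 2 * (∑' j, lam (j + (m - 1)))⁻¹ *
    (∑' j, lam (j + (m - 1))) = 1 by field_simp; norm_num, ENNReal.ofReal_one]

end Density

/-! ### Tail bounds for the weighted samples -/

section Sampling

variable {D : Type*} {H : Type*} [NormedAddCommGroup H] [InnerProductSpace ℂ H] [CompleteSpace H]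
  [RKHS ℂ H D ℂ] {lam : ℕ → ℝ} {e : ℕ → H} {m : ℕ} {ι : Type*}

/-- The conjugate values of a finite system of functions, divided by the root of the density. -/
def sampleVec (lam : ℕ → ℝ) (e : ℕ → H) (m : ℕ) (F : ι → H) (x : D) : ι → ℂ :=
  fun i => star (F i x / (Real.sqrt (density lam e m x) : ℂ))

theorem measurable_sampleVec [MeasurableSpace D] [TopologicalSpace.SeparableSpace H]
    (hmeas : ∀ f : H, Measurable f) (F : ι → H) :
    Measurable (sampleVec lam e m F : D → ι → ℂ) := by
  refine measurable_pi_lambda _ fun i => ?_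
  have h := measurable_density (lam := lam) (e := e) (m := m) hmeas
  exact continuous_star.measurable.comp
    ((hmeas (F i)).div (Complex.measurable_ofReal.comp h.sqrt))

variable [Fintype ι]

theorem star_sampleVec_dotProduct (F : ι → H) (x : D) (v : ι → ℂ) :
    star (sampleVec lam e m F x) ⬝ᵥ v =
      ∑ i, F i x / (Real.sqrt (density lam e m x) : ℂ) * v i := by
  simp [sampleVec, dotProduct]

theorem sum_norm_sampleVec_sq_le {F : ι → H} {M : ℝ} (hM : 0 ≤ M) {x : D}
    (hd : 0 ≤ density lam e m x) (hF : ∑ i, ‖F i x‖ ^ 2 ≤ M * density lam e m x) :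
    ∑ i, ‖sampleVec lam e m F x i‖ ^ 2 ≤ M := by
  have h : ∑ i, ‖sampleVec lam e m F x i‖ ^ 2 = (∑ i, ‖F i x‖ ^ 2) / density lam e m x := by
    rw [Finset.sum_div]
    refine Finset.sum_congr rfl fun i _ => ?_
    rw [sampleVec, norm_star, norm_div, div_pow, Complex.norm_real, Real.norm_eq_abs, sq_abs,
      Real.sq_sqrt hd]
  rw [h]
  exact div_le_of_le_mul₀ hd hM hF

variable [MeasurableSpace D] [TopologicalSpace.SeparableSpace H]

variable {ρ : Measure D} {hmeas : ∀ f : H, Measurable f} {htr : FiniteTrace H ρ}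

/-- The weight 1/ϱ_m cancels against the density of the sampling measure, and the conjugation in
`sampleVec` puts the conjugate on `F i`. The mean matrix is thus the Gram matrix in L₂. -/
theorem integral_rankOne_sampleVec {F : ι → H} {M : ℝ}
    (hd : ∀ x : D, 0 ≤ density lam e m x)
    (hF : ∀ x, ∑ i, ‖F i x‖ ^ 2 ≤ M * density lam e m x) (i j : ι) :
    ∫ x, rankOne (sampleVec lam e m F x) i j ∂(samplingMeasure ρ lam e m) =
      ⟪F i, covOp ρ hmeas htr (F j)⟫_ℂ := by
  rw [samplingMeasure, integral_withDensity_eq_integral_toReal_smul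
    (measurable_density hmeas).ennreal_ofReal
    (Filter.Eventually.of_forall fun x => ENNReal.ofReal_lt_top), inner_covOp, L2.inner_def]
  refine integral_congr_ae ?_
  filter_upwards [coeFn_embedding ρ hmeas htr (F i), coeFn_embedding ρ hmeas htr (F j)]
    with x hi hj
  rw [hi, hj, ENNReal.toReal_ofReal (hd x), rankOne, Matrix.vecMulVec_apply, Pi.star_apply,
    sampleVec, sampleVec, star_star, RCLike.inner_apply]
  -- Where the density vanishes, `hF` forces all `F i x` to vanish, so nothing is lost there.
  rcases (hd x).eq_or_lt with h0 | h0
  · have h1 : ∀ i, F i x = 0 := fun i => by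
      have h2 := (Finset.single_le_sum (f := fun i => ‖F i x‖ ^ 2) (fun _ _ => sq_nonneg _)
        (Finset.mem_univ i)).trans (hF x)
      rw [← h0, mul_zero] at h2
      exact norm_eq_zero.1 (pow_eq_zero_iff two_ne_zero |>.1 (le_antisymm h2 (sq_nonneg _)))
    simp [h1]
  · have h1 : (Real.sqrt (density lam e m x) : ℂ) * (Real.sqrt (density lam e m x) : ℂ) =
        (density lam e m x : ℂ) := by
      rw [← Complex.ofReal_mul, Real.mul_self_sqrt h0.le]
    have h2 : (Real.sqrt (density lam e m x) : ℂ) ≠ 0 :=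
      Complex.ofReal_ne_zero.2 (Real.sqrt_pos.2 h0).ne'
    rw [Complex.real_smul, ← h1, star_div₀, RCLike.star_def, Complex.conj_ofReal]
    field_simp

/-- With high probability the weighted samples of the functions `η_j` have a well-conditioned
Gram matrix. -/
theorem IsEigenSystem.measureReal_gram_le (he : IsEigenSystem (covOp ρ hmeas htr) lam e)
    (hm : 2 ≤ m) (hpos : 0 < lam (m - 1)) {n p : ℕ} (hn : 0 < n)
    (hp : 96 * (p * ((m : ℝ) - 1)) ≤ n) :
    (Measure.pi fun _ : Fin n => samplingMeasure ρ lam e m).real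
      {X | ∃ v : Fin (m - 1) → ℂ, ∑ k, ‖∑ i : Fin (m - 1), eta lam e i (X k) /
        (Real.sqrt (density lam e m (X k)) : ℂ) * v i‖ ^ 2 < n / 4 * ∑ i, ‖v i‖ ^ 2} ≤
      (80 / 423) ^ p * ((m : ℝ) - 1) := by
  have := he.isProbabilityMeasure_samplingMeasure hm hpos
  have hd := he.density_nonneg he.summable hm hpos
  have h3 : (0 : ℝ) < (m : ℝ) - 1 := by
    have : (2 : ℝ) ≤ m := by exact_mod_cast hm
    linarith
  let F : Fin (m - 1) → H := fun i => eta lam e i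
  have hF : ∀ x, ∑ i, ‖F i x‖ ^ 2 ≤ 2 * ((m : ℝ) - 1) * density lam e m x := fun x => by
    have := he.sum_norm_eta_sq_le he.summable hm hpos x
    rwa [Finset.sum_range] at this
  have hΛ : ∀ i j, ∫ x, rankOne (sampleVec lam e m F x) i j ∂(samplingMeasure ρ lam e m) =
      (1 : Matrix (Fin (m - 1)) (Fin (m - 1)) ℂ) i j := fun i j => by
    rw [integral_rankOne_sampleVec (hmeas := hmeas) (htr := htr) hd hF]
    have hi := he.pos_of_lt hpos i.2
    have hj := he.pos_of_lt hpos j.2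
    simp only [F]
    rw [eta_eq_smul_eig hi, eta_eq_smul_eig hj, map_smul, he.apply_eig, inner_smul_left,
      inner_smul_right, inner_smul_right, he.inner_eig, Matrix.one_apply]
    by_cases hij : i = j
    · subst hij
      have hs : (sing lam i : ℂ) ≠ 0 := Complex.ofReal_ne_zero.2 (Real.sqrt_pos.2 hi).ne'
      have hs2 : (lam i : ℂ) = (sing lam i : ℂ) * (sing lam i : ℂ) := by
        rw [← Complex.ofReal_mul, sing, Real.mul_self_sqrt hi.le]
      simp only [hi, and_self, if_true, map_inv₀, Complex.conj_ofReal]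
      rw [hs2]
      field_simp
    · have : (i : ℕ) ≠ j := fun h => hij (Fin.ext h)
      simp [this, hij]
  -- With M = 2(m-1) the condition 2pM ≤ n/24 is exactly `hp`.
  have h := measureReal_lower_tail_le (μ := samplingMeasure ρ lam e m) (n := n) (p := p) hn
    (measurable_sampleVec hmeas F)
    (fun x => sum_norm_sampleVec_sq_le (by positivity) (hd x) (hF x)) (by positivity) hΛ
    (by linarith)
  simp only [star_sampleVec_dotProduct, Fintype.card_fin] at h
  rwa [Nat.cast_sub (by omega), Nat.cast_one] at h

/-- With high probability the weighted samples of the functions in the unit ball orthogonal to the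
first `m - 1` eigenvectors are small in the mean square. -/
theorem IsEigenSystem.measure_tail_le (he : IsEigenSystem (covOp ρ hmeas htr) lam e)
    (hm : 2 ≤ m) (hpos : 0 < lam (m - 1)) {n p : ℕ} {R s : ℝ} (hs : 0 < s)
    (hR : n * lam (m - 1) ≤ R) (hpR : p * (∑' j, lam (j + (m - 1))) ≤ R)
    (hTR : 4 * (∑' j, lam (j + (m - 1))) ≤ 3 * R) :
    (Measure.pi fun _ : Fin n => samplingMeasure ρ lam e m)
      {X | ∃ J, ∃ c : ℕ → ℂ, s * ∑ j ∈ Finset.range J, ‖c j‖ ^ 2 <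
        ∑ k, ‖∑ j ∈ Finset.range J, eig lam e (j + (m - 1)) (X k) /
          (Real.sqrt (density lam e m (X k)) : ℂ) * c j‖ ^ 2} ≤
      ENNReal.ofReal
        ((4 * R) ^ p * (n * ∑' j, lam (j + (m - 1))) / s ^ (p + 1)) := by
  have := he.isProbabilityMeasure_samplingMeasure hm hpos
  have hd := he.density_nonneg he.summable hm hpos
  have hT := he.tsum_pos he.summable hpos
  have hsum := (summable_nat_add_iff (m - 1)).2 he.summable
  set T := ∑' j, lam (j + (m - 1))
  let B : ℕ → Set (Fin n → D) := fun J => {X | ∃ c : ℕ → ℂ,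
    s * ∑ j ∈ Finset.range J, ‖c j‖ ^ 2 <
        ∑ k, ‖∑ j ∈ Finset.range J, eig lam e (j + (m - 1)) (X k) /
          (Real.sqrt (density lam e m (X k)) : ℂ) * c j‖ ^ 2}
  -- Padding with zeros makes the events increase with J. Continuity from below needs no
  -- measurability for increasing sets, so a bound uniform in J covers their union.
  have hBmono : Monotone B := by
    rintro J J' hJ X ⟨c, hc⟩
    refine ⟨fun j => if j < J then c j else 0, ?_⟩
    have h1 : ∀ a : ℕ → ℂ, ∑ j ∈ Finset.range J', a j * (if j < J then c j else 0) =
        ∑ j ∈ Finset.range J, a j * c j := fun a => by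
      rw [← Finset.sum_subset (Finset.range_mono hJ)]
      · exact Finset.sum_congr rfl fun j hj => by rw [if_pos (Finset.mem_range.1 hj)]
      · intro j _ hj
        rw [if_neg (fun h => hj (Finset.mem_range.2 h)), mul_zero]
    have h2 : ∑ j ∈ Finset.range J', ‖if j < J then c j else 0‖ ^ 2 =
        ∑ j ∈ Finset.range J, ‖c j‖ ^ 2 := by
      rw [← Finset.sum_subset (Finset.range_mono hJ)]
      · exact Finset.sum_congr rfl fun j hj => by rw [if_pos (Finset.mem_range.1 hj)]
      · intro j _ hj
        rw [if_neg (fun h => hj (Finset.mem_range.2 h)), norm_zero]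
        norm_num
    rw [h2]
    refine hc.trans_eq (Finset.sum_congr rfl fun k _ => ?_)
    rw [h1]
  have hset : {X : Fin n → D | ∃ J, ∃ c : ℕ → ℂ, s * ∑ j ∈ Finset.range J, ‖c j‖ ^ 2 <
        ∑ k, ‖∑ j ∈ Finset.range J, eig lam e (j + (m - 1)) (X k) /
          (Real.sqrt (density lam e m (X k)) : ℂ) * c j‖ ^ 2} = ⋃ J, B J := by
    ext X
    rw [Set.mem_iUnion]
    rfl
  rw [hset, hBmono.measure_iUnion]
  refine iSup_le fun J => ?_
  let F : Fin J → H := fun i => eig lam e (i + (m - 1))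
  have hF : ∀ x, ∑ i, ‖F i x‖ ^ 2 ≤ 2 * T * density lam e m x := fun x => by
    have := he.sum_norm_eig_tail_sq_le he.summable hm hpos J x
    rwa [Finset.sum_range] at this
  have hΛ : ∀ i j, ∫ x, rankOne (sampleVec lam e m F x) i j ∂(samplingMeasure ρ lam e m) =
      Matrix.diagonal (fun i : Fin J => ((lam (i + (m - 1)) : ℝ) : ℂ)) i j := fun i j => by
    rw [integral_rankOne_sampleVec (hmeas := hmeas) (htr := htr) hd hF]
    simp only [F]
    rw [he.apply_eig, inner_smul_right, he.inner_eig, Matrix.diagonal_apply]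
    by_cases hij : i = j
    · subst hij
      by_cases h : 0 < lam (i + (m - 1))
      · simp [h]
      · simp [le_antisymm (not_lt.1 h) (he.nonneg _)]
    · have : (i : ℕ) ≠ j := fun h => hij (Fin.ext h)
      simp [this, hij]
  have hR0 : 0 ≤ R := by linarith
  have h := measureReal_upper_tail_le (μ := samplingMeasure ρ lam e m) (n := n) (p := p) (R := R)
    (T := T) (measurable_sampleVec hmeas F)
    (fun x => sum_norm_sampleVec_sq_le (by positivity) (hd x) (hF x)) hΛ hR0 (by positivity) hs
    (fun i => le_trans (mul_le_mul_of_nonneg_left (he.antitone (by omega)) (Nat.cast_nonneg n)) hR)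
    (by
      rw [← Finset.sum_range fun j => lam (j + (m - 1))]
      exact hsum.sum_le_tsum _ fun j _ => he.nonneg _)
    (by linarith) (by linarith)
  simp only [star_sampleVec_dotProduct] at h
  rw [← ENNReal.ofReal_toReal (measure_ne_top _ (B J))]
  refine ENNReal.ofReal_le_ofReal (le_trans (measureReal_mono ?_ (measure_ne_top _ _)) h)
  rintro X ⟨c, hc⟩
  refine ⟨fun i => c i, ?_⟩
  simp only [Finset.sum_range] at hc
  exact hc

end Sampling


/-! ### Deterministic error analysis of least squares -/

section LeastSquares

variable {D : Type*} {H : Type*} [NormedAddCommGroup H] [InnerProductSpace ℂ H] [CompleteSpace H]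
  [RKHS ℂ H D ℂ] {lam : ℕ → ℝ} {e : ℕ → H} {m n : ℕ}

/-- Division by √0 = 0 already gives 0, so the case distinction disappears. -/
theorem weightedMatrix_apply (X : Fin n → D) (k : Fin n) (j : Fin (m - 1)) :
    weightedMatrix lam e m X k j = eta lam e j (X k) / (Real.sqrt (density lam e m (X k)) : ℂ) := by
  rw [weightedMatrix, Matrix.of_apply]
  split_ifs with h
  · simp [h]
  · rfl

theorem weightedSamples_apply (X : Fin n → D) (f : H) (k : Fin n) :
    weightedSamples lam e m X f k = f (X k) / (Real.sqrt (density lam e m (X k)) : ℂ) := by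
  rw [weightedSamples]
  split_ifs with h
  · simp [h]
  · rfl

theorem star_dotProduct_gram_mulVec {p q : Type*} [Fintype p] [Fintype q] (L : Matrix p q ℂ)
    (v w : q → ℂ) : star v ⬝ᵥ ((Lᴴ * L) *ᵥ w) = star (L *ᵥ v) ⬝ᵥ (L *ᵥ w) := by
  rw [← Matrix.mulVec_mulVec, Matrix.dotProduct_mulVec, Matrix.star_mulVec]

theorem isUnit_gram_of_le {p q : Type*} [Fintype p] [Fintype q] [DecidableEq q]
    {L : Matrix p q ℂ} {a : ℝ} (ha : 0 < a)
    (h : ∀ v, a * ∑ i, ‖v i‖ ^ 2 ≤ ∑ k, ‖(L *ᵥ v) k‖ ^ 2) : IsUnit (Lᴴ * L).det := by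
  rw [isUnit_iff_ne_zero]
  intro hdet
  obtain ⟨v, hv, hGv⟩ := Matrix.exists_mulVec_eq_zero_iff.2 hdet
  have h1 := star_dotProduct_gram_mulVec L v v
  rw [hGv, dotProduct_zero, star_dotProduct_self] at h1
  have h2 : ∑ k, ‖(L *ᵥ v) k‖ ^ 2 = 0 := by exact_mod_cast h1.symm
  have h3 : ∑ i, ‖v i‖ ^ 2 ≤ 0 := by
    have := h v
    rw [h2] at this
    exact nonpos_of_mul_nonpos_right this ha
  refine hv (funext fun i => ?_)
  have h4 := (Finset.single_le_sum (f := fun i => ‖v i‖ ^ 2) (fun _ _ => sq_nonneg _)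
    (Finset.mem_univ i)).trans h3
  exact norm_eq_zero.1 (pow_eq_zero_iff two_ne_zero |>.1 (le_antisymm h4 (sq_nonneg _)))

open scoped ComplexOrder in
theorem rank_eq_card_iff_gram {p q : Type*} [Fintype p] [Fintype q] [DecidableEq q]
    (L : Matrix p q ℂ) : L.rank = Fintype.card q ↔ (Lᴴ * L).det ≠ 0 := by
  rw [← Matrix.rank_conjTranspose_mul_self]
  refine ⟨fun h hdet => ?_, fun h => Matrix.rank_of_isUnit _
    ((Matrix.isUnit_iff_isUnit_det _).2 (isUnit_iff_ne_zero.2 h))⟩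
  have h1 : Function.Surjective (Lᴴ * L).mulVecLin := by
    rw [← LinearMap.range_eq_top]
    refine Submodule.eq_top_of_finrank_eq ?_
    rw [Module.finrank_fintype_fun_eq_card]
    exact h
  have h2 := LinearMap.injective_iff_surjective.2 h1
  obtain ⟨v, hv, hGv⟩ := Matrix.exists_mulVec_eq_zero_iff.2 hdet
  exact hv (h2 (by simpa using hGv))

/-- The solution of the normal equations is bounded by the data. -/
theorem sum_norm_sq_normalSolution_le {p q : Type*} [Fintype p] [Fintype q] [DecidableEq q]
    {L : Matrix p q ℂ} {a : ℝ} (ha : 0 < a)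
    (h : ∀ v, a * ∑ i, ‖v i‖ ^ 2 ≤ ∑ k, ‖(L *ᵥ v) k‖ ^ 2) (g : p → ℂ) :
    a * ∑ i, ‖((Lᴴ * L)⁻¹ *ᵥ (Lᴴ *ᵥ g)) i‖ ^ 2 ≤ ∑ k, ‖g k‖ ^ 2 := by
  set d := (Lᴴ * L)⁻¹ *ᵥ (Lᴴ *ᵥ g)
  refine (h d).trans ?_
  have h1 : (Lᴴ * L) *ᵥ d = Lᴴ *ᵥ g := by
    rw [Matrix.mulVec_mulVec, Matrix.mul_nonsing_inv _ (isUnit_gram_of_le ha h),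
      Matrix.one_mulVec]
  have h2 : star (L *ᵥ d) ⬝ᵥ g = ((∑ k, ‖(L *ᵥ d) k‖ ^ 2 : ℝ) : ℂ) := by
    rw [← star_dotProduct_self, ← star_dotProduct_gram_mulVec, h1, Matrix.dotProduct_mulVec,
      Matrix.star_mulVec]
  have h3 : star (L *ᵥ d - g) ⬝ᵥ (L *ᵥ d - g) =
      ((∑ k, ‖g k‖ ^ 2 - ∑ k, ‖(L *ᵥ d) k‖ ^ 2 : ℝ) : ℂ) := by
    have h4 : star g ⬝ᵥ (L *ᵥ d) = ((∑ k, ‖(L *ᵥ d) k‖ ^ 2 : ℝ) : ℂ) := by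
      rw [Matrix.star_dotProduct, h2, RCLike.star_def, Complex.conj_ofReal]
    rw [star_sub, sub_dotProduct, dotProduct_sub, dotProduct_sub, h2, h4, star_dotProduct_self,
      star_dotProduct_self]
    push_cast
    ring
  rw [star_dotProduct_self] at h3
  have h5 := Complex.ofReal_injective h3
  have h6 : 0 ≤ ∑ k, ‖(L *ᵥ d - g) k‖ ^ 2 := Finset.sum_nonneg fun _ _ => sq_nonneg _
  linarith

variable [MeasurableSpace D] {ρ : Measure D} {hmeas : ∀ f : H, Measurable f}
  {htr : FiniteTrace H ρ}

/-- Pythagoras in L₂: the η_j are orthonormal there, and orthogonality of `r` to an eigenvector in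
`H` carries over to L₂. -/
theorem IsEigenSystem.norm_embedding_sum_eta_sq (he : IsEigenSystem (covOp ρ hmeas htr) lam e)
    (hpos : 0 < lam (m - 1)) (d : Fin (m - 1) → ℂ) {r : H}
    (hr : ∀ j < m - 1, ⟪eig lam e j, r⟫_ℂ = 0) :
    ‖embedding ρ hmeas htr (r - ∑ j, d j • eta lam e j)‖ ^ 2 =
      ‖embedding ρ hmeas htr r‖ ^ 2 + ∑ j, ‖d j‖ ^ 2 := by
  let c : ℕ → ℂ := fun j => if h : j < m - 1 then d ⟨j, h⟩ * (sing lam j : ℂ)⁻¹ else 0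
  have hu : ∑ j, d j • eta lam e j = ∑ j ∈ Finset.range (m - 1), c j • eig lam e j := by
    rw [Finset.sum_range]
    refine Finset.sum_congr rfl fun j _ => ?_
    rw [eta_eq_smul_eig (he.pos_of_lt hpos j.2), smul_smul]
    simp [c]
  have hn : ‖embedding ρ hmeas htr (∑ j, d j • eta lam e j)‖ ^ 2 = ∑ j, ‖d j‖ ^ 2 := by
    rw [hu, he.norm_embedding_sum_sq, Finset.sum_range]
    refine Finset.sum_congr rfl fun j _ => ?_
    have hj := he.pos_of_lt hpos j.2
    simp only [c, j.2, dif_pos, norm_mul, norm_inv, Complex.norm_real, Real.norm_eq_abs, mul_pow,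
      inv_pow, sq_abs, sing, Real.sq_sqrt hj.le]
    field_simp
  have ho : ⟪embedding ρ hmeas htr r, embedding ρ hmeas htr (∑ j, d j • eta lam e j)⟫_ℂ = 0 := by
    rw [hu, map_sum, inner_sum]
    refine Finset.sum_eq_zero fun j hj => ?_
    rw [map_smul, inner_smul_right, he.inner_embedding_eig_eq_zero, mul_zero]
    rw [← inner_conj_symm, hr j (Finset.mem_range.1 hj), map_zero]
  rw [map_sub, norm_sub_sq (𝕜 := ℂ), ho, hn, map_zero, mul_zero, sub_zero]

theorem IsEigenSystem.inner_eig_remainder (he : IsEigenSystem (covOp ρ hmeas htr) lam e)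
    {N j : ℕ} (hj : j < N) (hpos : 0 < lam j) (f : H) :
    ⟪eig lam e j, remainder lam e N f⟫_ℂ = 0 := by
  rw [remainder, inner_sub_right, inner_sum,
    Finset.sum_eq_single_of_mem j (Finset.mem_range.2 hj) fun i _ hij => by
      rw [inner_smul_right, he.inner_eig, if_neg fun h => hij h.1.symm, mul_zero],
    inner_smul_right, he.inner_eig]
  simp [hpos]

/-- The samples of the projection of f are L applied to its coefficients a, and (L*L)⁻¹L*La = a; the
projection is reproduced and cancels. -/
theorem IsEigenSystem.sub_approximant (he : IsEigenSystem (covOp ρ hmeas htr) lam e)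
    (hpos : 0 < lam (m - 1)) (X : Fin n → D)
    (hunit : IsUnit ((weightedMatrix lam e m X)ᴴ * weightedMatrix lam e m X).det) (f : H) :
    f - approximant lam e m X f = remainder lam e (m - 1) f -
      ∑ j, coeffs lam e m X (remainder lam e (m - 1) f) j • eta lam e j := by
  set L := weightedMatrix lam e m X with hL
  let a : Fin (m - 1) → ℂ := fun j => (sing lam j : ℂ) * ⟪eig lam e j, f⟫_ℂ
  have ha : ∑ j, a j • eta lam e j =
      ∑ j ∈ Finset.range (m - 1), ⟪eig lam e j, f⟫_ℂ • eig lam e j := by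
    rw [Finset.sum_range]
    refine Finset.sum_congr rfl fun j _ => ?_
    have hj := he.pos_of_lt hpos j.2
    have hs : (sing lam j : ℂ) ≠ 0 := Complex.ofReal_ne_zero.2 (Real.sqrt_pos.2 hj).ne'
    rw [eta_eq_smul_eig hj, smul_smul]
    simp only [a]
    congr 1
    field_simp
  have hf : f = ∑ j, a j • eta lam e j + remainder lam e (m - 1) f := by
    rw [ha, remainder, add_sub_cancel]
  have hsamp : weightedSamples lam e m X f = L *ᵥ a +
      weightedSamples lam e m X (remainder lam e (m - 1) f) := by
    funext k
    have hfk : f (X k) = ∑ j, a j * eta lam e j (X k) + remainder lam e (m - 1) f (X k) := by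
      conv_lhs => rw [hf]
      rw [RKHS.coe_add, Pi.add_apply]
      congr 1
      simp only [← inner_kernelSection (X k), inner_sum, inner_smul_right]
    rw [Pi.add_apply, weightedSamples_apply, weightedSamples_apply, hfk, Matrix.mulVec, dotProduct,
      add_div, Finset.sum_div]
    congr 1
    refine Finset.sum_congr rfl fun j _ => ?_
    rw [hL, weightedMatrix_apply]
    ring
  have hco : coeffs lam e m X f = a + coeffs lam e m X (remainder lam e (m - 1) f) := by
    unfold coeffs
    rw [hsamp, ← hL, Matrix.mulVec_add, Matrix.mulVec_add, Matrix.mulVec_mulVec,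
      Matrix.mulVec_mulVec, Matrix.mul_assoc, Matrix.nonsing_inv_mul _ hunit, Matrix.one_mulVec]
  rw [approximant, hco]
  simp only [Pi.add_apply, add_smul, Finset.sum_add_distrib]
  rw [ha, ← sub_sub]
  rfl

/-- At regular nodes the remainder is the limit of the finite sums in `hB` with c_j = ⟨e_{j+m-1},
f⟩, whose square sum is at most ‖f‖² by Bessel's inequality. -/
theorem IsEigenSystem.sum_norm_sq_samples_remainder_le
    (he : IsEigenSystem (covOp ρ hmeas htr) lam e) {X : Fin n → D} {s : ℝ} (hs : 0 ≤ s)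
    (hX : ∀ k, IsRegular lam e (X k))
    (hB : ∀ (J : ℕ) (c : ℕ → ℂ), ∑ k, ‖∑ j ∈ Finset.range J, eig lam e (j + (m - 1)) (X k) /
      (Real.sqrt (density lam e m (X k)) : ℂ) * c j‖ ^ 2 ≤ s * ∑ j ∈ Finset.range J, ‖c j‖ ^ 2)
    (f : H) :
    ∑ k, ‖weightedSamples lam e m X (remainder lam e (m - 1) f) k‖ ^ 2 ≤ s * ‖f‖ ^ 2 := by
  have h1 : Filter.Tendsto (fun J => ∑ k, ‖∑ j ∈ Finset.range J, eig lam e (j + (m - 1)) (X k) /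
      (Real.sqrt (density lam e m (X k)) : ℂ) * ⟪eig lam e (j + (m - 1)), f⟫_ℂ‖ ^ 2) Filter.atTop
      (nhds (∑ k, ‖weightedSamples lam e m X (remainder lam e (m - 1) f) k‖ ^ 2)) := by
    refine tendsto_finsetSum _ fun k _ => (Filter.Tendsto.norm ?_).pow 2
    have h2 := (((hX k).hasSum_remainder he (m - 1) f).div_const
      (Real.sqrt (density lam e m (X k)) : ℂ)).tendsto_sum_nat
    rw [weightedSamples_apply]
    refine h2.congr fun J => Finset.sum_congr rfl fun j _ => ?_
    ring
  refine le_of_tendsto h1 (Filter.Eventually.of_forall fun J => (hB J _).trans ?_)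
  refine mul_le_mul_of_nonneg_left ?_ hs
  have h3 := he.sum_norm_inner_sq_le f ((Finset.range J).map (addRightEmbedding (m - 1)))
  rwa [Finset.sum_map] at h3

/-- The error estimate for nodes with a well-conditioned Gram matrix. -/
theorem IsEigenSystem.mem_successSet [TopologicalSpace.SeparableSpace H]
    (he : IsEigenSystem (covOp ρ hmeas htr) lam e)
    (hpos : 0 < lam (m - 1)) (hn : 0 < n) {X : Fin n → D} {s t : ℝ} (hs : 0 ≤ s)
    (hX : ∀ k, IsRegular lam e (X k))
    (hA : ∀ v : Fin (m - 1) → ℂ, n / 4 * ∑ i, ‖v i‖ ^ 2 ≤ ∑ k, ‖∑ i : Fin (m - 1),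
      eta lam e i (X k) / (Real.sqrt (density lam e m (X k)) : ℂ) * v i‖ ^ 2)
    (hB : ∀ (J : ℕ) (c : ℕ → ℂ), ∑ k, ‖∑ j ∈ Finset.range J, eig lam e (j + (m - 1)) (X k) /
      (Real.sqrt (density lam e m (X k)) : ℂ) * c j‖ ^ 2 ≤ s * ∑ j ∈ Finset.range J, ‖c j‖ ^ 2)
    (ht : lam (m - 1) + 4 * s / n ≤ t) :
    X ∈ successSet ρ hmeas htr lam e m n t := by
  have hn' : (0 : ℝ) < n / 4 := by
    have : (0 : ℝ) < n := by exact_mod_cast hn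
    positivity
  have hL : ∀ v, n / 4 * ∑ i, ‖v i‖ ^ 2 ≤ ∑ k, ‖(weightedMatrix lam e m X *ᵥ v) k‖ ^ 2 :=
    fun v => by
      simpa only [Matrix.mulVec, dotProduct, weightedMatrix_apply] using hA v
  have hunit := isUnit_gram_of_le hn' hL
  refine ⟨?_, iSup₂_le fun f hf => ?_⟩
  · have := (rank_eq_card_iff_gram (weightedMatrix lam e m X)).2 hunit.ne_zero
    rwa [Fintype.card_fin] at this
  · rw [he.sub_approximant hpos X hunit, ← ofReal_norm, ← ENNReal.ofReal_pow (norm_nonneg _)]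
    refine ENNReal.ofReal_le_ofReal ?_
    rw [he.norm_embedding_sum_eta_sq hpos _ fun j hj =>
      he.inner_eig_remainder hj (he.pos_of_lt hpos hj) f]
    have h1 := he.norm_embedding_remainder_sq_le (m - 1) f
    have h2 := sum_norm_sq_normalSolution_le hn' hL
      (weightedSamples lam e m X (remainder lam e (m - 1) f))
    have h3 := he.sum_norm_sq_samples_remainder_le hs hX hB f
    have h4 : ‖f‖ ^ 2 ≤ 1 := pow_le_one₀ (norm_nonneg _) hf
    have h5 : lam (m - 1) * ‖f‖ ^ 2 ≤ lam (m - 1) := mul_le_of_le_one_right hpos.le h4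
    have h6 : s * ‖f‖ ^ 2 ≤ s := mul_le_of_le_one_right hs h4
    have h7 : ∑ j, ‖coeffs lam e m X (remainder lam e (m - 1) f) j‖ ^ 2 ≤ 4 * s / n := by
      have h8 := (h2.trans h3).trans h6
      change n / 4 * ∑ j, ‖coeffs lam e m X (remainder lam e (m - 1) f) j‖ ^ 2 ≤ s at h8
      rw [← le_div_iff₀' hn'] at h8
      refine h8.trans_eq ?_
      field_simp
    linarith

end LeastSquares

/-! ### Measurability of the success set -/

section Measurability

variable {D : Type*} {H : Type*} [NormedAddCommGroup H] [InnerProductSpace ℂ H] [CompleteSpace H]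
  [RKHS ℂ H D ℂ] {lam : ℕ → ℝ} {e : ℕ → H} {m n : ℕ}

theorem continuous_approximant (X : Fin n → D) :
    Continuous fun f : H => approximant lam e m X f := by
  unfold approximant
  refine continuous_finsetSum _ fun j _ => Continuous.smul ?_ continuous_const
  unfold coeffs
  refine (continuous_apply j).comp (continuous_const.matrix_mulVec
    (continuous_const.matrix_mulVec (continuous_pi fun k => ?_)))
  simp only [weightedSamples_apply]
  exact (RKHS.continuous_eval (X k)).div_const _

variable [MeasurableSpace D] [TopologicalSpace.SeparableSpace H]

theorem measurable_weightedMatrix (hmeas : ∀ f : H, Measurable f) :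
    Measurable fun (X : Fin n → D) (k : Fin n) (j : Fin (m - 1)) => weightedMatrix lam e m X k j := by
  refine measurable_pi_lambda _ fun k => measurable_pi_lambda _ fun j => ?_
  simp only [weightedMatrix_apply]
  exact ((hmeas _).comp (measurable_pi_apply k)).div (Complex.measurable_ofReal.comp
    ((measurable_density hmeas).sqrt.comp (measurable_pi_apply k)))

theorem measurable_weightedSamples (hmeas : ∀ f : H, Measurable f) (f : H) :
    Measurable fun (X : Fin n → D) => weightedSamples lam e m X f := by
  refine measurable_pi_lambda _ fun k => ?_
  simp only [weightedSamples_apply]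
  exact ((hmeas _).comp (measurable_pi_apply k)).div (Complex.measurable_ofReal.comp
    ((measurable_density hmeas).sqrt.comp (measurable_pi_apply k)))

theorem continuous_gram :
    Continuous fun A : Fin n → Fin (m - 1) → ℂ => (Matrix.of A)ᴴ * Matrix.of A := by
  have h : Continuous fun A : Fin n → Fin (m - 1) → ℂ => Matrix.of A := continuous_id
  exact h.matrix_conjTranspose.matrix_mul h

theorem measurable_det_gram (hmeas : ∀ f : H, Measurable f) :
    Measurable fun X : Fin n → D =>
      ((weightedMatrix lam e m X)ᴴ * weightedMatrix lam e m X).det :=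
  continuous_gram.matrix_det.measurable.comp (measurable_weightedMatrix hmeas)

/-- The matrix inverse equals det⁻¹ times the adjugate also for singular matrices, where both are
zero, so measurability holds without any rank condition. -/
theorem measurable_coeffs (hmeas : ∀ f : H, Measurable f) (f : H) (j : Fin (m - 1)) :
    Measurable fun X : Fin n → D => coeffs lam e m X f j := by
  have h1 : ∀ X : Fin n → D, coeffs lam e m X f j =
      ((weightedMatrix lam e m X)ᴴ * weightedMatrix lam e m X).det⁻¹ *
        (((weightedMatrix lam e m X)ᴴ * weightedMatrix lam e m X).adjugate *ᵥ
          ((weightedMatrix lam e m X)ᴴ *ᵥ weightedSamples lam e m X f)) j := fun X => by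
    rw [coeffs, Matrix.inv_def, Ring.inverse_eq_inv', Matrix.smul_mulVec, Pi.smul_apply,
      smul_eq_mul]
  simp only [h1]
  refine (measurable_det_gram hmeas).inv.mul ?_
  simp only [Matrix.mulVec, dotProduct]
  refine Finset.measurable_fun_sum _ fun i _ => Measurable.mul ?_ ?_
  · have h2 : Continuous fun A : Fin n → Fin (m - 1) → ℂ =>
        ((Matrix.of A)ᴴ * Matrix.of A).adjugate j i :=
      continuous_gram.matrix_adjugate.matrix_elem j i
    exact h2.measurable.comp (measurable_weightedMatrix hmeas)
  · refine Finset.measurable_fun_sum _ fun k _ => Measurable.mul ?_ ?_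
    · have h3 := measurable_pi_iff.1 (measurable_pi_iff.1
        (measurable_weightedMatrix (lam := lam) (e := e) (m := m) (n := n) hmeas) k) i
      exact continuous_star.measurable.comp h3
    · exact measurable_pi_iff.1 (measurable_weightedSamples hmeas f) k

variable (ρ : Measure D) (hmeas : ∀ f : H, Measurable f) (htr : FiniteTrace H ρ)

theorem measurable_enorm_sub_approximant (f : H) :
    Measurable fun X : Fin n → D => ‖embedding ρ hmeas htr (f - approximant lam e m X f)‖ₑ := by
  have h : ∀ X : Fin n → D, embedding ρ hmeas htr (f - approximant lam e m X f) =
      embedding ρ hmeas htr f -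
        ∑ j : Fin (m - 1), coeffs lam e m X f j • embedding ρ hmeas htr (eta lam e j) := fun X => by
    rw [map_sub, approximant, map_sum]
    simp only [map_smul]
  simp only [h]
  refine StronglyMeasurable.enorm (stronglyMeasurable_const.sub
    (Finset.stronglyMeasurable_fun_sum _ fun j _ => ?_))
  exact (measurable_coeffs hmeas f j).stronglyMeasurable.smul_const _

/-- For fixed nodes the error is continuous in f, so the supremum condition need only be checked on
a countable dense subset of the unit ball; full rank means a nonzero Gram determinant. -/
theorem measurableSet_successSet (t : ℝ) :
    MeasurableSet (successSet ρ hmeas htr lam e m n t) := by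
  obtain ⟨c, hcV, hc, hVc⟩ := (TopologicalSpace.IsSeparable.of_separableSpace
    (Metric.closedBall (0 : H) 1)).exists_countable_dense_subset
  have h : successSet ρ hmeas htr lam e m n t =
      {X | ((weightedMatrix lam e m X)ᴴ * weightedMatrix lam e m X).det ≠ 0} ∩
      ⋂ f ∈ c, {X | ‖embedding ρ hmeas htr (f - approximant lam e m X f)‖ₑ ^ 2 ≤
        ENNReal.ofReal t} := by
    ext X
    have h1 := rank_eq_card_iff_gram (weightedMatrix lam e m X)
    rw [Fintype.card_fin] at h1
    refine and_congr h1 ?_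
    rw [worstCaseErrorSq, iSup₂_le_iff, Set.mem_iInter₂]
    refine ⟨fun h f hf => h f (by simpa using hcV hf), fun h f hf => ?_⟩
    have hcont : Continuous fun f : H =>
        ‖embedding ρ hmeas htr (f - approximant lam e m X f)‖ₑ ^ 2 := by
      have := continuous_approximant (lam := lam) (e := e) (m := m) X
      fun_prop
    have hcl : IsClosed {f : H | ‖embedding ρ hmeas htr (f - approximant lam e m X f)‖ₑ ^ 2 ≤
        ENNReal.ofReal t} := isClosed_le hcont continuous_const
    exact closure_minimal (fun f hf => h f hf) hcl (hVc (by simpa using hf))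
  rw [h]
  refine MeasurableSet.inter ?_ (MeasurableSet.biInter hc fun f _ => ?_)
  · exact (measurableSet_singleton 0).compl.preimage (measurable_det_gram hmeas)
  · exact measurableSet_le ((measurable_enorm_sub_approximant ρ hmeas htr f).pow_const 2)
      measurable_const

end Measurability


/-! ### Numerical constants and choice of the exponents -/

section Constants

theorem constC_lt : constC < 49.5 := by
  have h2 : Real.sqrt 2 < 1.41422 := by
    rw [Real.sqrt_lt' (by norm_num)]; norm_num
  have hlog : Real.log 8 = 3 * Real.log 2 := by
    rw [show (8 : ℝ) = 2 ^ 3 by norm_num, Real.log_pow]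
    norm_num
  have h3 : (2.039 : ℝ) < Real.sqrt (2 * Real.log 8) := by
    rw [Real.lt_sqrt (by norm_num), hlog]
    nlinarith [Real.log_two_gt_d9]
  have h4 : constR < 1.53685 := by
    have : 1 / (4 * Real.sqrt (2 * Real.log 8)) < 1 / (4 * 2.039) :=
      one_div_lt_one_div_of_lt (by norm_num) (by linarith)
    rw [constR]
    refine lt_of_lt_of_le (add_lt_add h2 this) ?_
    norm_num
  have h5 : 0 ≤ constR := by
    rw [constR]; positivity
  have h6 : constR ^ 2 < 1.53685 ^ 2 := pow_lt_pow_left₀ h4 h5 two_ne_zero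
  have h7 : Real.sqrt 2 * constR ≤ 1.41422 * 1.53685 := by gcongr
  rw [constC, mul_assoc]
  norm_num at h6 h7 ⊢
  linarith

/-- C_R ≥ √2 already gives C ≥ 3 + 32 + 8. The value 41 = 1 + 40 is what the final error estimate
consumes. -/
theorem le_constC : 41 ≤ constC := by
  have h2 : Real.sqrt 2 ^ 2 = 2 := Real.sq_sqrt (by norm_num)
  have h3 : Real.sqrt 2 ≤ constR := by
    rw [constR]
    have : 0 ≤ 1 / (4 * Real.sqrt (2 * Real.log 8)) := by positivity
    linarith
  have h4 : 2 ≤ constR ^ 2 := by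
    rw [← h2]
    exact pow_le_pow_left₀ (Real.sqrt_nonneg _) h3 2
  have h5 : 2 ≤ Real.sqrt 2 * constR := by
    have := mul_le_mul_of_nonneg_left h3 (Real.sqrt_nonneg 2)
    rwa [← sq, h2] at this
  rw [constC, mul_assoc]
  linarith

variable {δ : ℝ} {n m : ℕ}

theorem samples_pos (hm : m = ⌊(n : ℝ) / (96 * (Real.sqrt 2 * Real.log (2 * n) - Real.log δ))⌋₊)
    (hm₂ : 2 ≤ m) : 0 < n := by
  rcases Nat.eq_zero_or_pos n with h | h
  · subst h
    simp at hm
    omega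
  · exact h

theorem oversampling (hδ₀ : 0 < δ) (hδ₁ : δ < 1 / 3)
    (hm : m = ⌊(n : ℝ) / (96 * (Real.sqrt 2 * Real.log (2 * n) - Real.log δ))⌋₊) (hm₂ : 2 ≤ m) :
    96 * (m * (Real.sqrt 2 * Real.log (2 * n) - Real.log δ)) ≤ n ∧
      3 ≤ Real.sqrt 2 * Real.log (2 * n) - Real.log δ := by
  have hn : (1 : ℝ) ≤ n := by exact_mod_cast samples_pos hm hm₂
  have h2 : 1 ≤ Real.sqrt 2 := Real.one_le_sqrt.2 (by norm_num)
  have hlogn : 0 ≤ Real.log (2 * n) := Real.log_nonneg (by linarith)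
  have hδ : Real.log δ ≤ -1 := by
    rw [Real.log_le_iff_le_exp hδ₀, Real.exp_neg]
    refine hδ₁.le.trans ?_
    rw [one_div]
    exact inv_anti₀ (Real.exp_pos 1) (by linarith [Real.exp_one_lt_d9])
  set L := Real.sqrt 2 * Real.log (2 * n) - Real.log δ
  have hL : 1 ≤ L := by
    have : 0 ≤ Real.sqrt 2 * Real.log (2 * n) := by positivity
    linarith
  have h3 : (m : ℝ) ≤ n / (96 * L) := by
    rw [hm]
    exact Nat.floor_le (by positivity)
  rw [le_div_iff₀ (by positivity)] at h3
  refine ⟨by linarith, ?_⟩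
  have hm' : (2 : ℝ) ≤ m := by exact_mod_cast hm₂
  -- A bootstrap: L ≥ 1 and m ≥ 2 force n ≥ 192, hence log(2n) ≥ 2, and with -log δ ≥ 1 this
  -- improves to L ≥ 3.
  have h4 : (192 : ℝ) ≤ n := by nlinarith
  have h5 : 2 ≤ Real.log (2 * n) := by
    rw [Real.le_log_iff_exp_le (by linarith)]
    have h6 : Real.exp 2 = Real.exp 1 * Real.exp 1 := by rw [← Real.exp_add]; norm_num
    nlinarith [Real.exp_one_lt_d9, Real.exp_pos 1]
  nlinarith

/-- Take p = ⌊L⌋. As 80/423 ≤ e^(-3/2) and (3/2)(L - 1) ≥ L for L ≥ 3, the power is at most e^(-L) ≤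
δ/(2n), which pays for the dimension m-1 ≤ 2n. -/
theorem gram_failure_le (hδ₀ : 0 < δ) (hδ₁ : δ < 1 / 3)
    (hm : m = ⌊(n : ℝ) / (96 * (Real.sqrt 2 * Real.log (2 * n) - Real.log δ))⌋₊) (hm₂ : 2 ≤ m) :
    ∃ p : ℕ, 96 * (p * ((m : ℝ) - 1)) ≤ n ∧ (80 / 423) ^ p * ((m : ℝ) - 1) ≤ δ := by
  obtain ⟨h1, h3⟩ := oversampling hδ₀ hδ₁ hm hm₂
  have hn : (1 : ℝ) ≤ n := by exact_mod_cast samples_pos hm hm₂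
  have hm' : (2 : ℝ) ≤ m := by exact_mod_cast hm₂
  have hlogn : 0 ≤ Real.log (2 * n) := Real.log_nonneg (by linarith)
  have h2 : 1 ≤ Real.sqrt 2 := Real.one_le_sqrt.2 (by norm_num)
  have hLle : Real.log (2 * n) - Real.log δ ≤ Real.sqrt 2 * Real.log (2 * n) - Real.log δ := by
    nlinarith
  set L := Real.sqrt 2 * Real.log (2 * n) - Real.log δ
  have hp : (⌊L⌋₊ : ℝ) ≤ L := Nat.floor_le (by linarith)
  have hp' : L - 1 ≤ ⌊L⌋₊ := (Nat.sub_one_lt_floor L).le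
  refine ⟨⌊L⌋₊, ?_, ?_⟩
  · have : (⌊L⌋₊ : ℝ) * ((m : ℝ) - 1) ≤ L * m := by
      gcongr <;> linarith
    linarith
  · have h4 : (80 / 423 : ℝ) ≤ Real.exp (-(3 / 2)) := by
      rw [Real.exp_neg]
      have h5 : Real.exp (3 / 2) ^ 2 = Real.exp 1 ^ 3 := by
        rw [← Real.exp_nat_mul, ← Real.exp_nat_mul]; norm_num
      have h6 : Real.exp 1 ^ 3 ≤ 2.7182818286 ^ 3 :=
        pow_le_pow_left₀ (Real.exp_pos 1).le Real.exp_one_lt_d9.le 3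
      have h7 : Real.exp (3 / 2) ≤ 423 / 80 := by
        refine le_of_sq_le_sq ?_ (by norm_num)
        rw [h5]
        refine h6.trans ?_
        norm_num
      calc (80 / 423 : ℝ) = (423 / 80)⁻¹ := by norm_num
        _ ≤ _ := inv_anti₀ (Real.exp_pos _) h7
    have h5 : (80 / 423 : ℝ) ^ ⌊L⌋₊ ≤ Real.exp (-(Real.log (2 * n) - Real.log δ)) := by
      refine (pow_le_pow_left₀ (by norm_num) h4 _).trans ?_
      rw [← Real.exp_nat_mul, Real.exp_le_exp]
      linarith
    have h6 : Real.exp (-(Real.log (2 * n) - Real.log δ)) = δ / (2 * n) := by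
      rw [neg_sub, Real.exp_sub, Real.exp_log hδ₀, Real.exp_log (by linarith)]
    have h7 : (m : ℝ) - 1 ≤ 2 * n := by nlinarith
    calc (80 / 423 : ℝ) ^ ⌊L⌋₊ * ((m : ℝ) - 1) ≤ δ / (2 * n) * (2 * n) := by
          rw [← h6]
          gcongr
          linarith
      _ = δ := by field_simp

/-- Take p = ⌊log(8n)⌋ and threshold s = 10R/δ. Then 4R/s = 2δ/5 ≤ e⁻¹, so the p-th power is at most
e/(8n), which cancels the factor n; the last factor 1/s supplies δ. -/
theorem tail_failure_le {T R : ℝ} (hδ₀ : 0 < δ) (hδ₁ : δ < 1 / 3) (hn : 0 < n) (hT : 0 < T)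
    (hR : Real.log (8 * n) * T ≤ R) :
    ∃ p : ℕ, p * T ≤ R ∧ 4 * T ≤ 3 * R ∧
      (4 * R) ^ p * (n * T) / (10 * R / δ) ^ (p + 1) ≤ δ := by
  have hn' : (1 : ℝ) ≤ n := by exact_mod_cast hn
  have hlog : 2 ≤ Real.log (8 * n) := by
    rw [Real.le_log_iff_exp_le (by linarith)]
    have h6 : Real.exp 2 = Real.exp 1 * Real.exp 1 := by rw [← Real.exp_add]; norm_num
    nlinarith [Real.exp_one_lt_d9, Real.exp_pos 1]
  set l := Real.log (8 * n) with hl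
  have hp : (⌊l⌋₊ : ℝ) ≤ l := Nat.floor_le (by linarith)
  have hp' : l - 1 ≤ ⌊l⌋₊ := (Nat.sub_one_lt_floor l).le
  have hTR : 2 * T ≤ R := le_trans (mul_le_mul_of_nonneg_right hlog hT.le) hR
  have hR0 : 0 < R := by linarith
  refine ⟨⌊l⌋₊, le_trans (mul_le_mul_of_nonneg_right hp hT.le) hR, by linarith, ?_⟩
  have e : (4 * R) ^ ⌊l⌋₊ * (n * T) / (10 * R / δ) ^ (⌊l⌋₊ + 1) =
      (2 / 5 * δ) ^ ⌊l⌋₊ * n * (T / R) / 10 * δ := by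
    rw [pow_succ, show 4 * R = (2 / 5 * δ) * (10 * R / δ) by field_simp; norm_num, mul_pow]
    field_simp
  rw [e]
  have h1 : (2 / 5 * δ) ^ ⌊l⌋₊ ≤ Real.exp 1 / (8 * n) := by
    have h2 : 2 / 5 * δ ≤ Real.exp (-1) := by
      rw [Real.exp_neg]
      have : (3 : ℝ)⁻¹ ≤ (Real.exp 1)⁻¹ :=
        inv_anti₀ (Real.exp_pos 1) (by linarith [Real.exp_one_lt_d9])
      refine le_trans ?_ this
      linarith
    refine (pow_le_pow_left₀ (by positivity) h2 _).trans ?_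
    have h3 : Real.exp 1 / (8 * n) = Real.exp (1 - l) := by
      rw [Real.exp_sub, hl, Real.exp_log (by linarith)]
    rw [← Real.exp_nat_mul, h3, Real.exp_le_exp]
    linarith
  have h2 : T / R ≤ 1 := by
    rw [div_le_one hR0]
    linarith
  have h3 : (2 / 5 * δ) ^ ⌊l⌋₊ * n * (T / R) / 10 ≤ 1 := by
    calc (2 / 5 * δ) ^ ⌊l⌋₊ * n * (T / R) / 10 ≤ Real.exp 1 / (8 * n) * n * 1 / 10 := by gcongr
      _ = Real.exp 1 / 80 := by field_simp; norm_num
      _ ≤ 1 := by linarith [Real.exp_one_lt_d9]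
  exact mul_le_of_le_one_left hδ₀.le h3

end Constants

/-! ### Assembly of the probability estimate -/

section Main

variable {D : Type*} {H : Type*} [NormedAddCommGroup H] [InnerProductSpace ℂ H] [CompleteSpace H]
  [RKHS ℂ H D ℂ] [MeasurableSpace D] [TopologicalSpace.SeparableSpace H] {lam : ℕ → ℝ} {e : ℕ → H}
  {m n : ℕ} {ρ : Measure D} {hmeas : ∀ f : H, Measurable f} {htr : FiniteTrace H ρ}

theorem IsEigenSystem.ae_forall_isRegular (he : IsEigenSystem (covOp ρ hmeas htr) lam e)
    (hm : 2 ≤ m) (hpos : 0 < lam (m - 1)) :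
    ∀ᵐ X ∂(Measure.pi fun _ : Fin n => samplingMeasure ρ lam e m), ∀ k, IsRegular lam e (X k) := by
  have := he.isProbabilityMeasure_samplingMeasure hm hpos
  rw [ae_all_iff]
  intro k
  exact Measure.tendsto_eval_ae_ae.eventually
    ((withDensity_absolutelyContinuous ρ _).ae_le he.ae_isRegular)

theorem IsEigenSystem.le_measureReal_successSet (he : IsEigenSystem (covOp ρ hmeas htr) lam e)
    {δ : ℝ} (hδ₀ : 0 < δ) (hδ₁ : δ < 1 / 3)
    (hm : m = ⌊(n : ℝ) / (96 * (Real.sqrt 2 * Real.log (2 * n) - Real.log δ))⌋₊)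
    (hm₂ : 2 ≤ m) (hpos : 0 < lam (m - 1)) :
    1 - 3 * δ ≤ (Measure.pi fun _ : Fin n => samplingMeasure ρ lam e m).real
      (successSet ρ hmeas htr lam e m n (constC / δ *
        max (lam (m - 1)) (Real.log (8 * n) / n * ∑' j, lam (j + (m - 1))))) := by
  have := he.isProbabilityMeasure_samplingMeasure hm₂ hpos
  have hn := samples_pos hm hm₂
  have hn' : (0 : ℝ) < n := by exact_mod_cast hn
  have hT := he.tsum_pos he.summable hpos
  set T := ∑' j, lam (j + (m - 1)) with hTdef
  set mx := max (lam (m - 1)) (Real.log (8 * n) / n * T)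
  have hmx : 0 < mx := hpos.trans_le (le_max_left _ _)
  have hR1 : n * lam (m - 1) ≤ n * mx := by
    gcongr
    exact le_max_left _ _
  have hR2 : Real.log (8 * n) * T ≤ n * mx := by
    have : Real.log (8 * n) / n * T ≤ mx := le_max_right _ _
    calc Real.log (8 * n) * T = n * (Real.log (8 * n) / n * T) := by field_simp
      _ ≤ n * mx := by gcongr
  obtain ⟨p, hp1, hp2⟩ := gram_failure_le hδ₀ hδ₁ hm hm₂
  obtain ⟨q, hq1, hq2, hq3⟩ := tail_failure_le hδ₀ hδ₁ hn hT hR2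
  -- This is the threshold of `tail_failure_le` with R = n·mx, the smallest multiple of n given by
  -- the two terms of the maximum.
  set s := 10 * (n * mx) / δ with hs_def
  have hs : 0 < s := by positivity
  have hA := (he.measureReal_gram_le hm₂ hpos hn hp1).trans hp2
  have hB := ENNReal.toReal_le_of_le_ofReal hδ₀.le
    ((he.measure_tail_le (n := n) (s := s) hm₂ hpos hs hR1 hq1 hq2).trans
      (ENNReal.ofReal_le_ofReal hq3))
  have hG := he.ae_forall_isRegular (n := n) hm₂ hpos
  rw [ae_iff] at hG
  set P := Measure.pi fun _ : Fin n => samplingMeasure ρ lam e m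
  set A : Set (Fin n → D) := {X | ∃ v : Fin (m - 1) → ℂ, ∑ k, ‖∑ i : Fin (m - 1),
    eta lam e i (X k) / (Real.sqrt (density lam e m (X k)) : ℂ) * v i‖ ^ 2 <
      n / 4 * ∑ i, ‖v i‖ ^ 2}
  set B : Set (Fin n → D) := {X | ∃ J, ∃ c : ℕ → ℂ, s * ∑ j ∈ Finset.range J, ‖c j‖ ^ 2 <
        ∑ k, ‖∑ j ∈ Finset.range J, eig lam e (j + (m - 1)) (X k) /
          (Real.sqrt (density lam e m (X k)) : ℂ) * c j‖ ^ 2}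
  set G : Set (Fin n → D) := {X | ¬ ∀ k, IsRegular lam e (X k)}
  set S := successSet ρ hmeas htr lam e m n (constC / δ * mx)
  -- Failure is contained in `A` and `B`, of probability at most δ each, and in the null set `G`.
  -- Outside them the error is at most λ_m + 4s/n ≤ (1 + 40) mx/δ.
  have hcover : (Set.univ : Set (Fin n → D)) ⊆ S ∪ (A ∪ (B ∪ G)) := by
    intro X _
    by_cases hXA : X ∈ A
    · exact Or.inr (Or.inl hXA)
    by_cases hXB : X ∈ B
    · exact Or.inr (Or.inr (Or.inl hXB))
    by_cases hXG : X ∈ G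
    · exact Or.inr (Or.inr (Or.inr hXG))
    refine Or.inl (he.mem_successSet hpos hn hs.le (not_not.1 hXG)
      (fun v => not_lt.1 fun h => hXA ⟨v, h⟩)
      (fun J c => not_lt.1 fun h => hXB ⟨J, c, h⟩) ?_)
    have h1 : 4 * s / n = 40 / δ * mx := by
      rw [hs_def]
      field_simp
      norm_num
    have h2 : lam (m - 1) ≤ 1 / δ * mx := by
      refine (le_max_left _ _ : lam (m - 1) ≤ mx).trans (le_mul_of_one_le_left hmx.le ?_)
      rw [le_div_iff₀ hδ₀]
      linarith
    have h3 : 41 / δ * mx ≤ constC / δ * mx := by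
      gcongr
      exact le_constC
    have h4 : 41 / δ * mx = 1 / δ * mx + 40 / δ * mx := by ring
    linarith
  have hG' : P.real G = 0 := by
    rw [measureReal_def, hG, ENNReal.toReal_zero]
  have h1 : (1 : ℝ) = P.real Set.univ := by simp [P]
  have h2 : P.real Set.univ ≤ P.real S + (P.real A + (P.real B + P.real G)) :=
    (measureReal_mono hcover (measure_ne_top _ _)).trans ((measureReal_union_le _ _).trans
      (add_le_add le_rfl ((measureReal_union_le _ _).trans
        (add_le_add le_rfl (measureReal_union_le _ _)))))
  have hB' : P.real B ≤ δ := hB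
  linarith

end Main

end WLS

end

theorem theorem5p7 {D : Type*} [MeasurableSpace D] {H : Type*}
    [NormedAddCommGroup H] [InnerProductSpace ℂ H] [CompleteSpace H] [RKHS ℂ H D ℂ]
    [TopologicalSpace.SeparableSpace H]
    (ρ : Measure D) [SigmaFinite ρ]
    (hmeas : ∀ f : H, Measurable f) (htr : WLS.FiniteTrace H ρ)
    (lam : ℕ → ℝ) (e : ℕ → H)
    (he : WLS.IsEigenSystem (WLS.covOp ρ hmeas htr) lam e)
    (δ : ℝ) (hδ₀ : 0 < δ) (hδ₁ : δ < 1 / 3) (n m : ℕ)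
    (hm : m = ⌊(n : ℝ) / (96 * (Real.sqrt 2 * Real.log (2 * n) - Real.log δ))⌋₊)
    (hm₂ : 2 ≤ m) (hpos : 0 < lam (m - 1)) :
    WLS.constC < 49.5 ∧
    Summable (fun j => WLS.sing lam j ^ 2) ∧
    IsProbabilityMeasure (WLS.samplingMeasure ρ lam e m) ∧
    (∀ t : ℝ, MeasurableSet (WLS.successSet ρ hmeas htr lam e m n t)) ∧
    1 - 3 * δ ≤ (Measure.pi fun _ : Fin n => WLS.samplingMeasure ρ lam e m).real
      (WLS.successSet ρ hmeas htr lam e m n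
        (WLS.constC / δ *
          max (WLS.sing lam (m - 1) ^ 2)
            (Real.log (8 * n) / n * ∑' j, WLS.sing lam (j + (m - 1)) ^ 2))) := by
  have hsing : ∀ j, WLS.sing lam j ^ 2 = lam j := fun j => Real.sq_sqrt (he.nonneg j)
  simp only [hsing]
  exact ⟨WLS.constC_lt, he.summable, he.isProbabilityMeasure_samplingMeasure hm₂ hpos,
    WLS.measurableSet_successSet ρ hmeas htr, he.le_measureReal_successSet hδ₀ hδ₁ hm hm₂ hpos⟩
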